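/- For a real $p\times p$ matrix $A$ let $\sigma_{\max}(A)=\sigma_1(A)\ge\dots\ge\sigma_p(A)=\sigma_{\min}(A)\ge 0$ be its singular values, $\|A\|_{op}=\sigma_1(A)$, $\|A\|_{1}=\sum_i\sigma_i(A)$ the nuclear norm and $\|A\|_F$ the Frobenius norm; for $q\in[0,1]$ and $R_q>0$ let $\mathbb{B}_q(R_q)=\{A:\sum_{i=1}^p\sigma_i(A)^q\le R_q\}$, with $0^0=0$ (so $\mathbb{B}_0(R_0)$ is the set of matrices of rank at most $R_0$). There are universal constants $c_0,c_1,c_2,c_3>0$ such that the following holds for all integers $p\ge 1$ and $n>c_0p$. Let $(Z_t)_{t\ge 1}$ be a stationary process in $\mathbb{R}^p$ with $Z_{t+1}=\Theta^*Z_t+W_t$ for $t\ge1$, where the innovations $W_t$ are i.i.d. $N(0,\nu^2I)$, $\nu>0$, and independent of $Z_1$. Suppose that $\|\Theta^*\|_{op}\le\gamma<1$ and $\Theta^*\in\mathbb{B}_q(R_q)$ with $q\in[0,1]$, $R_q>0$, and let $\Sigma$ be the stationary covariance matrix, i.e. the solution of $\Sigma=\Theta^*\Sigma(\Theta^*)^T+\nu^2I$.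 Put $\lambda=\frac{80\,\|\Sigma\|_{op}}{1-\gamma}\sqrt{\frac pn}$. Then with probability greater than $1-c_2\exp(-c_3p)$, every solution $$\widehat\Theta\in\arg\min_{\Theta\in\mathbb{R}^{p\times p}}\Big\{\frac1{2n}\sum_{t=1}^n\|Z_{t+1}-\Theta Z_t\|_2^2+\lambda\|\Theta\|_1\Big\}$$ satisfies $$\|\widehat\Theta-\Theta^*\|_F^2\le c_1\Big[\frac{\sigma_{\max}(\Sigma)}{\sigma_{\min}(\Sigma)(1-\gamma)}\Big]^{2-q}R_q\Big(\frac pn\Big)^{1-q/2}.$$ -/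

import Mathlib

open MeasureTheory ProbabilityTheory

noncomputable section

/-- The singular values `σ₁ ≥ σ₂ ≥ … ≥ σ_p ≥ 0` of a real `p × p` matrix, zero-indexed:
`singVal A i` is `σ_{i+1}(A)`, and it is `0` for `p ≤ i`. -/
def singVal {p : ℕ} (A : Matrix (Fin p) (Fin p) ℝ) (i : ℕ) : ℝ :=
  (Matrix.toEuclideanLin A).singularValues i

/-- The largest singular value `σ_max(A) = σ₁(A)`, which is the operator norm `‖A‖_op`. -/
def sigmaMax {p : ℕ} (A : Matrix (Fin p) (Fin p) ℝ) : ℝ := singVal A 0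

/-- The smallest singular value `σ_min(A) = σ_p(A)` (for `1 ≤ p`). -/
def sigmaMin {p : ℕ} (A : Matrix (Fin p) (Fin p) ℝ) : ℝ := singVal A (p - 1)

/-- The nuclear norm: the sum of the singular values. -/
def nuclearNorm {p : ℕ} (A : Matrix (Fin p) (Fin p) ℝ) : ℝ :=
  ∑ i ∈ Finset.range p, singVal A i

/-- The Frobenius norm `√(trace (AᵀA))`. -/
def frobNorm {p : ℕ} (A : Matrix (Fin p) (Fin p) ℝ) : ℝ :=
  Real.sqrt (Matrix.trace (A.transpose * A))

/-- The `ℓ_q`-"ball" `𝔹_q(R)` of near low-rank matrices: `∑ σ_i(A)^q ≤ R`, with the convention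
`0 ^ 0 = 0`, so that for `q = 0` it consists of the matrices of rank at most `R`. -/
def nearLowRankBall (p : ℕ) (q R : ℝ) : Set (Matrix (Fin p) (Fin p) ℝ) :=
  {A | ∑ i ∈ Finset.range p, (if singVal A i = 0 then 0 else singVal A i ^ q) ≤ R}

/-- `Z` is a (strictly) stationary vector autoregressive process with system matrix `Θ` and
Gaussian innovations `W`: the `W t` are i.i.d. `N(0, ν² I)` and independent of the initialization
`Z 0`, `Z (t + 1) = Θ Z t + W t`, and the law of the process is invariant under time shifts.
Time starts at `0`. -/
structure IsStationaryGaussianVAR {Ω : Type*} [MeasurableSpace Ω] (μ : Measure Ω) {p : ℕ}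
    (Θ : Matrix (Fin p) (Fin p) ℝ) (ν : ℝ) (Z W : ℕ → Ω → EuclideanSpace ℝ (Fin p)) : Prop where
  measurable_init : Measurable (Z 0)
  measurable_noise : ∀ t, Measurable (W t)
  noise_law : ∀ t, μ.map (W t) =
    multivariateGaussian 0 (ν ^ 2 • (1 : Matrix (Fin p) (Fin p) ℝ))
  noise_indep : iIndepFun W μ
  init_indep : IndepFun (Z 0) (fun ω t => W t ω) μ
  recursion : ∀ t ω, Z (t + 1) ω = Matrix.toEuclideanLin Θ (Z t ω) + W t ω
  stationary : ∀ h : ℕ, IdentDistrib (fun ω t => Z (t + h) ω) (fun ω t => Z t ω) μ μ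

/-- The nuclear-norm regularized least-squares objective for the `n` observed transitions
`z t ↦ z (t + 1)`, `t = 0, …, n - 1`, with regularization parameter `lam`. -/
def varObjective {p : ℕ} (n : ℕ) (z : ℕ → EuclideanSpace ℝ (Fin p)) (lam : ℝ)
    (Θ : Matrix (Fin p) (Fin p) ℝ) : ℝ :=
  1 / (2 * (n : ℝ)) * ∑ t ∈ Finset.range n, ‖z (t + 1) - Matrix.toEuclideanLin Θ (z t)‖ ^ 2
    + lam * nuclearNorm Θ

/-- `Θhat` is an optimal solution of the nuclear-norm regularized program. -/
def IsVarSolution {p : ℕ} (n : ℕ) (z : ℕ → EuclideanSpace ℝ (Fin p)) (lam : ℝ)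
    (Θhat : Matrix (Fin p) (Fin p) ℝ) : Prop :=
  IsMinOn (varObjective n z lam) Set.univ Θhat

end

/-! Write `s = √(p/n)/(1-γ)`, `M = σ_max(Σ)`, `m = σ_min(Σ)`, so that `λ = 80 M s`, and let `D` be
the difference between a solution and `Θ*`.

Deterministic half. Comparing objectives at the solution and at `Θ*` bounds `(1/2n) ∑ ‖D Z_t‖²` by
the pairing of `D` with the noise matrix `(1/n) ∑ W_t Z_tᵀ` plus `λ` times the drop in nuclear norm.
If the noise matrix has operator norm at most `λ/2`, nuclear/operator duality bounds the right side
by a term of order `√k ‖D‖_F`, for any chosen `k` singular directions of `Θ*`, plus the tail of its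
singular values (`hsInner_add_nuc_sub_le`). If also `∑ Z_t Z_tᵀ ≥ (n/2) m I`, cutting the spectrum
at `4λ/m` balances the two terms and gives the rate (`sq_le_of_quadratic_bound`).

Probabilistic half. Stationarity and the Lyapunov equation force `Z_t ~ N(0, Σ)`. In a fixed
direction the observations form a Gaussian vector in `ℝⁿ` whose covariances decay like `γ^|s-t|`, so
its covariance operator is of order `M/(1-γ)`. A Chernoff bound for Gaussian quadratic forms
(`measure_sum_sq_tails`) and a union bound over a `1/4`-net of `9^p` points then control operator
norms. The noise matrix, a cross term, is reduced to squares by polarization.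

The dichotomy. The curvature bound needs `n (1-γ)²` large compared with `p`, which `n > c₀ p` does
not give. For `s ≤ 1/20` it holds, with no condition number in the requirement, because it is proved
after whitening by `Σ` and `(1-γ²) M ≤ ν²`. For `s > 1/20` the penalty is so heavy that `(1/n) ∑
Z_{t+1} Z_tᵀ` has operator norm below `λ`, so every solution is `0`; the error is then `‖Θ*‖_F² ≤
R_q`, because all singular values are at most one, while the claimed bound exceeds `R_q`. -/

/-! ### Singular vectors, nuclear-norm duality and the oracle inequality. -/

noncomputable section HilbertSchmidt

open scoped RealInnerProductSpace

variable {E : Type*} [NormedAddCommGroup E] [InnerProductSpace ℝ E] [FiniteDimensional ℝ E]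

/-- The Hilbert–Schmidt inner product of two endomorphisms. -/
def hsInner (A B : E →ₗ[ℝ] E) : ℝ := LinearMap.trace ℝ E (A.adjoint ∘ₗ B)

theorem hsInner_eq_sum {ι : Type*} [Fintype ι] (b : OrthonormalBasis ι ℝ E) (A B : E →ₗ[ℝ] E) :
    hsInner A B = ∑ i, ⟪A (b i), B (b i)⟫ := by
  rw [hsInner, LinearMap.trace_eq_sum_inner _ b]
  simp [LinearMap.adjoint_inner_right]

theorem sum_norm_sq_eq_hsInner {ι : Type*} [Fintype ι] (b : OrthonormalBasis ι ℝ E)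
    (A : E →ₗ[ℝ] E) : ∑ i, ‖A (b i)‖ ^ 2 = hsInner A A := by
  simp [hsInner_eq_sum b]

theorem hsInner_self_nonneg (A : E →ₗ[ℝ] E) : 0 ≤ hsInner A A := by
  rw [← sum_norm_sq_eq_hsInner (stdOrthonormalBasis ℝ E)]
  positivity

theorem sum_norm_adjoint_sq_le {ι : Type*} {u : ι → E} {I : Finset ι}
    (hu : Orthonormal ℝ (fun i : I => u i)) (A : E →ₗ[ℝ] E) :
    ∑ i ∈ I, ‖A.adjoint (u i)‖ ^ 2 ≤ hsInner A A := by
  set b := stdOrthonormalBasis ℝ E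
  calc ∑ i ∈ I, ‖A.adjoint (u i)‖ ^ 2
      = ∑ i ∈ I, ∑ j, ⟪u i, A (b j)⟫ ^ 2 := by
        refine Finset.sum_congr rfl fun i _ => ?_
        rw [← b.sum_sq_norm_inner_right]
        refine Finset.sum_congr rfl fun j _ => ?_
        rw [LinearMap.adjoint_inner_right, real_inner_comm, Real.norm_eq_abs, sq_abs]
    _ = ∑ j, ∑ i ∈ I, ⟪u i, A (b j)⟫ ^ 2 := Finset.sum_comm
    _ ≤ ∑ j, ‖A (b j)‖ ^ 2 := by
        refine Finset.sum_le_sum fun j _ => ?_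
        have := hu.sum_inner_products_le (A (b j)) (s := Finset.univ)
        rw [← Finset.sum_coe_sort I]
        simpa using this
    _ = hsInner A A := sum_norm_sq_eq_hsInner b A

theorem hsInner_adjoint_self (A : E →ₗ[ℝ] E) : hsInner A.adjoint A.adjoint = hsInner A A := by
  rw [hsInner, hsInner, LinearMap.adjoint_adjoint, LinearMap.trace_comp_comm']

theorem sum_le_sqrt_card_mul {ι : Type*} (I : Finset ι) (f : ι → ℝ) {H : ℝ}
    (hH : ∑ i ∈ I, f i ^ 2 ≤ H) : ∑ i ∈ I, f i ≤ √(I.card) * √H := by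
  rw [← Real.sqrt_mul (Nat.cast_nonneg _)]
  refine Real.le_sqrt_of_sq_le ((sq_sum_le_card_mul_sum_sq).trans ?_)
  gcongr

/-- An orthonormal basis of right singular vectors. -/
def rightSingularBasis (A : E →ₗ[ℝ] E) {p : ℕ} (hp : Module.finrank ℝ E = p) :
    OrthonormalBasis (Fin p) ℝ E :=
  A.isSymmetric_adjoint_comp_self.eigenvectorBasis hp

variable {p : ℕ} (hp : Module.finrank ℝ E = p)

theorem adjoint_apply_rightSingularBasis (A : E →ₗ[ℝ] E) (i : Fin p) :
    A.adjoint (A (rightSingularBasis A hp i)) =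
      (A.singularValues i ^ 2) • rightSingularBasis A hp i := by
  have h := A.isSymmetric_adjoint_comp_self.apply_eigenvectorBasis hp i
  rw [A.sq_singularValues_fin hp]
  exact h

theorem inner_apply_rightSingularBasis (A : E →ₗ[ℝ] E) (i j : Fin p) :
    ⟪A (rightSingularBasis A hp i), A (rightSingularBasis A hp j)⟫ =
      if i = j then A.singularValues i ^ 2 else 0 := by
  rw [← LinearMap.adjoint_inner_left, adjoint_apply_rightSingularBasis, real_inner_smul_left,
    (rightSingularBasis A hp).inner_eq_ite]
  split_ifs <;> simp

theorem norm_apply_rightSingularBasis (A : E →ₗ[ℝ] E) (i : Fin p) :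
    ‖A (rightSingularBasis A hp i)‖ = A.singularValues i := by
  have h := inner_apply_rightSingularBasis hp A i i
  rw [if_pos rfl, real_inner_self_eq_norm_sq] at h
  exact (sq_eq_sq₀ (norm_nonneg _) (A.singularValues_nonneg _)).1 h

/-- The normalized image of the `i`-th right singular vector. -/
def leftSingularVector (A : E →ₗ[ℝ] E) (i : Fin p) : E :=
  (A.singularValues i)⁻¹ • A (rightSingularBasis A hp i)

theorem orthonormal_leftSingularVector (A : E →ₗ[ℝ] E) {I : Finset (Fin p)}
    (hI : ∀ i ∈ I, 0 < A.singularValues i) :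
    Orthonormal ℝ (fun i : I => leftSingularVector hp A i) := by
  rw [orthonormal_iff_ite]
  rintro ⟨i, hi⟩ ⟨j, hj⟩
  simp only [leftSingularVector, real_inner_smul_left, real_inner_smul_right,
    inner_apply_rightSingularBasis, Subtype.mk.injEq]
  have := (hI i hi).ne'
  split_ifs with h
  · subst h; field_simp
  · simp

theorem inner_leftSingularVector_apply (A : E →ₗ[ℝ] E) {i : Fin p}
    (hi : 0 < A.singularValues i) :
    ⟪leftSingularVector hp A i, A (rightSingularBasis A hp i)⟫ = A.singularValues i := by
  rw [leftSingularVector, real_inner_smul_left, inner_apply_rightSingularBasis, if_pos rfl]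
  field_simp

/-- The partial isometry `∑ i ∈ I, uᵢ vᵢᵀ` formed by the singular vectors with index in `I`. -/
def partialPolar (A : E →ₗ[ℝ] E) (I : Finset (Fin p)) : E →ₗ[ℝ] E :=
  ∑ i ∈ I, (innerₗ E (rightSingularBasis A hp i)).smulRight (leftSingularVector hp A i)

theorem partialPolar_apply (A : E →ₗ[ℝ] E) (I : Finset (Fin p)) (x : E) :
    partialPolar hp A I x =
      ∑ i ∈ I, ⟪rightSingularBasis A hp i, x⟫ • leftSingularVector hp A i := by
  simp [partialPolar, LinearMap.sum_apply]

theorem partialPolar_apply_basis (A : E →ₗ[ℝ] E) (I : Finset (Fin p)) (j : Fin p) :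
    partialPolar hp A I (rightSingularBasis A hp j) =
      if j ∈ I then leftSingularVector hp A j else 0 := by
  simp [partialPolar_apply, (rightSingularBasis A hp).inner_eq_ite]

omit [FiniteDimensional ℝ E] in
theorem norm_sq_sum_smul_orthonormal {ι : Type*} {u : ι → E} {I : Finset ι}
    (hu : Orthonormal ℝ (fun i : I => u i)) (c : ι → ℝ) :
    ‖∑ i ∈ I, c i • u i‖ ^ 2 = ∑ i ∈ I, c i ^ 2 := by
  rw [← Finset.sum_coe_sort I, ← Finset.sum_coe_sort I, ← real_inner_self_eq_norm_sq,
    hu.inner_sum (fun i => c i) (fun i => c i) Finset.univ]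
  simp [sq]

theorem norm_sq_partialPolar_apply (A : E →ₗ[ℝ] E) {I : Finset (Fin p)}
    (hI : ∀ i ∈ I, 0 < A.singularValues i) (x : E) :
    ‖partialPolar hp A I x‖ ^ 2 = ∑ i ∈ I, ⟪rightSingularBasis A hp i, x⟫ ^ 2 := by
  rw [partialPolar_apply, norm_sq_sum_smul_orthonormal (orthonormal_leftSingularVector hp A hI)]

/-- The nuclear norm of an endomorphism. -/
def nuc (A : E →ₗ[ℝ] E) (p : ℕ) : ℝ := ∑ i : Fin p, A.singularValues i

/-- Evaluate the trace in the right singular basis of `A`, where the columns of `A` have norms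
exactly the singular values. -/
theorem hsInner_le_nuc (hp : Module.finrank ℝ E = p) {K : E →ₗ[ℝ] E} {c : ℝ} (hK : ∀ x, ‖K x‖ ≤ c * ‖x‖) (A : E →ₗ[ℝ] E) :
    hsInner K A ≤ c * nuc A p := by
  rw [hsInner_eq_sum (rightSingularBasis A hp), nuc, Finset.mul_sum]
  refine Finset.sum_le_sum fun i _ => (real_inner_le_norm _ _).trans ?_
  rw [norm_apply_rightSingularBasis]
  gcongr
  · exact A.singularValues_nonneg _
  · simpa using hK (rightSingularBasis A hp i)

/-- The partial isometry of the polar decomposition, built from the nonzero singular values, attains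
equality in the duality bound. -/
theorem exists_hsInner_eq_nuc (hp : Module.finrank ℝ E = p) (A : E →ₗ[ℝ] E) :
    ∃ K : E →ₗ[ℝ] E, (∀ x, ‖K x‖ ≤ ‖x‖) ∧ hsInner K A = nuc A p := by
  classical
  set I : Finset (Fin p) := Finset.univ.filter fun i => 0 < A.singularValues i
  have hI : ∀ i ∈ I, 0 < A.singularValues i := fun i hi => (Finset.mem_filter.1 hi).2
  refine ⟨partialPolar hp A I, fun x => ?_, ?_⟩
  · refine le_of_sq_le_sq ?_ (norm_nonneg _)
    rw [norm_sq_partialPolar_apply hp A hI, ← (rightSingularBasis A hp).sum_sq_norm_inner_right x]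
    simp only [Real.norm_eq_abs, sq_abs]
    exact Finset.sum_le_sum_of_subset_of_nonneg (Finset.subset_univ _) fun _ _ _ => sq_nonneg _
  · rw [hsInner_eq_sum (rightSingularBasis A hp), nuc]
    refine Finset.sum_congr rfl fun i _ => ?_
    rw [partialPolar_apply_basis]
    split_ifs with h
    · exact inner_leftSingularVector_apply hp A (hI i h)
    · have : ¬ 0 < A.singularValues i := fun h' => h (by simp [I, h'])
      simp [le_antisymm (not_lt.1 this) (A.singularValues_nonneg _)]

/-- Split `D` into its compression `C`, orthogonal on both sides to the singular directions in `I`,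
and a remainder whose pairings cost `√|I| ‖D‖_F`. The nuclear norm grows by at least `nuc C`, up to
the remainder and twice the tail of `T`, while the noise gains at most `λ/2` times `nuc C`. The
penalty therefore absorbs the `C` part of the noise. -/
theorem hsInner_add_nuc_sub_le (hp : Module.finrank ℝ E = p) (T D N : E →ₗ[ℝ] E) {lam : ℝ}
    (hN : ∀ x, ‖N x‖ ≤ lam / 2 * ‖x‖) (I : Finset (Fin p))
    (hI : ∀ i ∈ I, 0 < T.singularValues i) (hlam : 0 ≤ lam) :
    hsInner N D + lam * (nuc T p - nuc (T + D) p) ≤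
      2 * lam * (√(I.card) * √(hsInner D D)) + 2 * lam * ∑ i ∈ Iᶜ, T.singularValues i := by
  classical
  set b := rightSingularBasis T hp
  set u := leftSingularVector hp T
  have hu : Orthonormal ℝ (fun i : I => u i) := orthonormal_leftSingularVector hp T hI
  -- `Q` is the orthogonal projection onto the left singular vectors in `I`, and `P` below plays the
  -- same role on the right.
  set Q : E →ₗ[ℝ] E := ∑ i ∈ I, (innerₗ E (u i)).smulRight (u i)
  have hQ : ∀ x, Q x = ∑ i ∈ I, ⟪u i, x⟫ • u i := fun x => by simp [Q, LinearMap.sum_apply]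
  have hQsymm : ∀ x y, ⟪Q x, y⟫ = ⟪x, Q y⟫ := fun x y => by
    rw [hQ, hQ, sum_inner, inner_sum]
    refine Finset.sum_congr rfl fun i _ => ?_
    rw [real_inner_smul_left, real_inner_smul_right, real_inner_comm x, mul_comm]
  have hQu : ∀ i ∈ I, Q (u i) = u i := fun i hi => by
    have h : ∀ j ∈ I, ⟪u j, u i⟫ = if j = i then 1 else 0 := fun j hj => by
      have := orthonormal_iff_ite.1 hu ⟨j, hj⟩ ⟨i, hi⟩
      simpa using this
    rw [hQ, Finset.sum_congr rfl fun j hj => by rw [h j hj]]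
    simp [hi]
  have hQQ : ∀ x, Q (Q x) = Q x := fun x => by
    conv_lhs => rw [hQ x]
    rw [map_sum, hQ x]
    exact Finset.sum_congr rfl fun i hi => by rw [map_smul, hQu i hi]
  have hpyth : ∀ x, ‖x‖ ^ 2 = ‖Q x‖ ^ 2 + ‖x - Q x‖ ^ 2 := fun x => by
    have h : ⟪Q x, x - Q x⟫ = 0 := by
      rw [inner_sub_right, hQsymm x (Q x), hQQ, real_inner_comm, ← hQsymm, sub_self]
    have := norm_add_sq_real (Q x) (x - Q x)
    rw [add_sub_cancel, h] at this
    linarith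
  have hcontr : ∀ x, ‖x - Q x‖ ≤ ‖x‖ := fun x => by
    refine le_of_sq_le_sq ?_ (norm_nonneg _)
    have := hpyth x
    nlinarith [sq_nonneg ‖Q x‖]
  have hres : ∀ x y, ⟪x - Q x, y⟫ = ⟪x, y - Q y⟫ := fun x y => by
    rw [inner_sub_left, inner_sub_right, hQsymm]
  -- the restriction of an endomorphism to the complement of the leading right singular vectors
  set P : E →ₗ[ℝ] E := ∑ i ∈ I, (innerₗ E (b i)).smulRight (b i)
  have hP : ∀ x, P x = ∑ i ∈ I, ⟪b i, x⟫ • b i := fun x => by simp [P, LinearMap.sum_apply]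
  have hPb : ∀ j, b j - P (b j) = if j ∈ I then 0 else b j := fun j => by
    rw [hP]
    simp only [b.inner_eq_ite]
    split_ifs with h <;> simp [h]
  have hPnorm : ∀ x, ‖x - P x‖ ^ 2 = ∑ i ∈ Iᶜ, ⟪b i, x⟫ ^ 2 := fun x => by
    have hx : x - P x = ∑ i ∈ Iᶜ, ⟪b i, x⟫ • b i := by
      rw [sub_eq_iff_eq_add, hP, Finset.sum_compl_add_sum, b.sum_repr' x]
    rw [hx, norm_sq_sum_smul_orthonormal]
    exact b.orthonormal.comp _ Subtype.val_injective
  set C : E →ₗ[ℝ] E := (LinearMap.id - Q) ∘ₗ D ∘ₗ (LinearMap.id - P)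
  obtain ⟨K, hK1, hK2⟩ := exists_hsInner_eq_nuc hp C
  -- Dual certificate: the polar part of `T` on `I` plus a contraction certifying `nuc C` on the
  -- complements. Ranges and supports are orthogonal, so `G` is a contraction, and testing `T + D`
  -- against it bounds `nuc (T + D)` below.
  set G : E →ₗ[ℝ] E := partialPolar hp T I + (LinearMap.id - Q) ∘ₗ K ∘ₗ (LinearMap.id - P)
  have hG : ∀ x, ‖G x‖ ≤ 1 * ‖x‖ := fun x => by
    rw [one_mul]
    refine le_of_sq_le_sq ?_ (norm_nonneg _)
    have hGx : G x = partialPolar hp T I x + (K (x - P x) - Q (K (x - P x))) := by simp [G]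
    have horth : ⟪partialPolar hp T I x, K (x - P x) - Q (K (x - P x))⟫ = 0 := by
      rw [← hres]
      have : Q (partialPolar hp T I x) = partialPolar hp T I x := by
        rw [partialPolar_apply, map_sum]
        exact Finset.sum_congr rfl fun i hi => by rw [map_smul]; exact congrArg _ (hQu i hi)
      rw [this, sub_self, inner_zero_left]
    rw [hGx, norm_add_sq_real, horth, norm_sq_partialPolar_apply hp T hI,
      ← b.sum_sq_norm_inner_right x]
    simp only [Real.norm_eq_abs, sq_abs]
    rw [← Finset.sum_add_sum_compl I, ← hPnorm]
    have : ‖K (x - P x) - Q (K (x - P x))‖ ≤ ‖x - P x‖ := (hcontr _).trans (hK1 _)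
    have := pow_le_pow_left₀ (norm_nonneg _) this 2
    linarith
  have hdual := hsInner_le_nuc hp hG (T + D)
  -- the three parts of the dual pairing
  have hGb : ∀ j, G (b j) = if j ∈ I then u j else K (b j) - Q (K (b j)) := fun j => by
    have : G (b j) = partialPolar hp T I (b j) +
        (K (b j - P (b j)) - Q (K (b j - P (b j)))) := by simp [G]
    rw [this, hPb, partialPolar_apply_basis]
    split_ifs <;> simp [u]
  have hCb : ∀ j, C (b j) = if j ∈ I then 0 else D (b j) - Q (D (b j)) := fun j => by
    have : C (b j) = D (b j - P (b j)) - Q (D (b j - P (b j))) := by simp [C]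
    rw [this, hPb]
    split_ifs <;> simp
  have hH : ∑ i ∈ I, ‖D (b i)‖ ≤ √(I.card) * √(hsInner D D) := by
    refine sum_le_sqrt_card_mul I _ ?_
    rw [← sum_norm_sq_eq_hsInner b]
    exact Finset.sum_le_sum_of_subset_of_nonneg (Finset.subset_univ _) fun _ _ _ => sq_nonneg _
  have hH' : ∑ i ∈ I, ‖D.adjoint (u i)‖ ≤ √(I.card) * √(hsInner D D) :=
    sum_le_sqrt_card_mul I _ (sum_norm_adjoint_sq_le hu D)
  have hunorm : ∀ i ∈ I, ‖u i‖ = 1 := fun i hi => hu.1 ⟨i, hi⟩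
  have hGT : ∑ i ∈ I, T.singularValues i - ∑ i ∈ Iᶜ, T.singularValues i ≤ hsInner G T := by
    rw [hsInner_eq_sum b, ← Finset.sum_add_sum_compl I, sub_eq_add_neg, ← Finset.sum_neg_distrib]
    refine add_le_add (Finset.sum_le_sum fun i hi => ?_) (Finset.sum_le_sum fun i hi => ?_)
    · rw [hGb, if_pos hi]
      exact (inner_leftSingularVector_apply hp T (hI i hi)).ge
    · rw [hGb, if_neg (Finset.mem_compl.1 hi)]
      refine neg_le_of_abs_le ((abs_real_inner_le_norm _ _).trans ?_)
      rw [norm_apply_rightSingularBasis]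
      refine mul_le_of_le_one_left (T.singularValues_nonneg _) ?_
      simpa using (hcontr _).trans (hK1 (b i))
  have hGD : nuc C p - √(I.card) * √(hsInner D D) ≤ hsInner G D := by
    rw [← hK2, hsInner_eq_sum b K, hsInner_eq_sum b G, ← Finset.sum_add_sum_compl I,
      ← Finset.sum_add_sum_compl I (fun i => ⟪G (b i), D (b i)⟫)]
    have h1 : ∑ i ∈ I, ⟪K (b i), C (b i)⟫ = 0 :=
      Finset.sum_eq_zero fun i hi => by rw [hCb, if_pos hi, inner_zero_right]
    have h2 : ∑ i ∈ Iᶜ, ⟪K (b i), C (b i)⟫ = ∑ i ∈ Iᶜ, ⟪G (b i), D (b i)⟫ :=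
      Finset.sum_congr rfl fun i hi => by
        rw [hCb, hGb, if_neg (Finset.mem_compl.1 hi), if_neg (Finset.mem_compl.1 hi), hres]
    have h3 : -∑ i ∈ I, ‖D (b i)‖ ≤ ∑ i ∈ I, ⟪G (b i), D (b i)⟫ := by
      rw [← Finset.sum_neg_distrib]
      refine Finset.sum_le_sum fun i hi => neg_le_of_abs_le ((abs_real_inner_le_norm _ _).trans ?_)
      rw [hGb, if_pos hi, hunorm i hi, one_mul]
    linarith
  have hGadd : hsInner G (T + D) = hsInner G T + hsInner G D := by
    simp [hsInner_eq_sum b, inner_add_right, Finset.sum_add_distrib]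
  have hnucT : nuc T p = ∑ i ∈ I, T.singularValues i + ∑ i ∈ Iᶜ, T.singularValues i := by
    rw [Finset.sum_add_sum_compl, nuc]
  -- the pairing with the noise
  have hND : hsInner N D ≤ lam / 2 * nuc C p + 2 * (lam / 2 * (√(I.card) * √(hsInner D D))) := by
    have hNC := hsInner_le_nuc hp hN C
    have hQpart : ∑ j, ⟪N (b j), Q (D (b j))⟫ ≤ lam / 2 * (√(I.card) * √(hsInner D D)) := by
      calc ∑ j, ⟪N (b j), Q (D (b j))⟫
          = ∑ j, ∑ i ∈ I, ⟪D.adjoint (u i), b j⟫ * ⟪b j, N.adjoint (u i)⟫ := by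
            refine Finset.sum_congr rfl fun j _ => ?_
            rw [hQ, inner_sum]
            refine Finset.sum_congr rfl fun i _ => ?_
            rw [real_inner_smul_right, LinearMap.adjoint_inner_left, LinearMap.adjoint_inner_right]
        _ = ∑ i ∈ I, ⟪D.adjoint (u i), N.adjoint (u i)⟫ := by
            rw [Finset.sum_comm]
            exact Finset.sum_congr rfl fun i _ => b.sum_inner_mul_inner _ _
        _ ≤ ∑ i ∈ I, lam / 2 * ‖D.adjoint (u i)‖ := by
            refine Finset.sum_le_sum fun i hi => ?_
            rw [LinearMap.adjoint_inner_right, real_inner_comm]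
            refine (real_inner_le_norm _ _).trans ?_
            rw [hunorm i hi, one_mul]
            exact hN _
        _ ≤ lam / 2 * (√(I.card) * √(hsInner D D)) := by
            rw [← Finset.mul_sum]
            gcongr
    have hRpart : ∑ j ∈ I, ⟪N (b j), D (b j) - Q (D (b j))⟫ ≤
        lam / 2 * (√(I.card) * √(hsInner D D)) := by
      calc ∑ j ∈ I, ⟪N (b j), D (b j) - Q (D (b j))⟫ ≤ ∑ j ∈ I, lam / 2 * ‖D (b j)‖ := by
            refine Finset.sum_le_sum fun j _ => (real_inner_le_norm _ _).trans ?_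
            gcongr
            · simpa using hN (b j)
            · exact hcontr _
        _ ≤ _ := by
            rw [← Finset.mul_sum]
            gcongr
    have hsplit : hsInner N D = ∑ j, ⟪N (b j), Q (D (b j))⟫ +
        ∑ j ∈ I, ⟪N (b j), D (b j) - Q (D (b j))⟫ + hsInner N C := by
      rw [hsInner_eq_sum b, hsInner_eq_sum b N C, ← Finset.sum_add_sum_compl I fun i =>
        ⟪N (b i), C (b i)⟫]
      have h1 : ∑ i ∈ I, ⟪N (b i), C (b i)⟫ = 0 :=
        Finset.sum_eq_zero fun i hi => by rw [hCb, if_pos hi, inner_zero_right]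
      have h2 : ∑ i ∈ Iᶜ, ⟪N (b i), C (b i)⟫ = ∑ i ∈ Iᶜ, ⟪N (b i), D (b i) - Q (D (b i))⟫ :=
        Finset.sum_congr rfl fun i hi => by rw [hCb, if_neg (Finset.mem_compl.1 hi)]
      rw [h1, h2, zero_add, add_assoc, Finset.sum_add_sum_compl, ← Finset.sum_add_distrib]
      refine Finset.sum_congr rfl fun j _ => ?_
      rw [← inner_add_right, add_sub_cancel]
    linarith
  have hCnn : 0 ≤ nuc C p := Finset.sum_nonneg fun i _ => C.singularValues_nonneg _
  have hmain : lam * (nuc T p - nuc (T + D) p) ≤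
      lam * (2 * ∑ i ∈ Iᶜ, T.singularValues i + √(I.card) * √(hsInner D D) - nuc C p) := by
    refine mul_le_mul_of_nonneg_left ?_ hlam
    linarith
  -- What remains of the `C` terms is `-(λ/2) nuc C`, which is discarded.
  nlinarith [mul_nonneg hlam hCnn]

end HilbertSchmidt

/-! ### Extreme singular values as bounds on norms and quadratic forms. -/

noncomputable section SingularValueBounds

open scoped RealInnerProductSpace

variable {E : Type*} [NormedAddCommGroup E] [InnerProductSpace ℝ E] [FiniteDimensional ℝ E] {p : ℕ}

theorem norm_sq_apply_eq_sum_singularValues (hp : Module.finrank ℝ E = p) (A : E →ₗ[ℝ] E) (x : E) :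
    ‖A x‖ ^ 2 = ∑ i : Fin p, A.singularValues i ^ 2 * ⟪rightSingularBasis A hp i, x⟫ ^ 2 := by
  rw [← real_inner_self_eq_norm_sq, ← LinearMap.adjoint_inner_left,
    ← (rightSingularBasis A hp).sum_inner_mul_inner]
  refine Finset.sum_congr rfl fun i _ => ?_
  rw [LinearMap.adjoint_inner_left, ← LinearMap.adjoint_inner_right,
    adjoint_apply_rightSingularBasis, real_inner_smul_right, real_inner_comm x]
  ring

theorem norm_apply_le_singularValues_zero (hp : Module.finrank ℝ E = p) (A : E →ₗ[ℝ] E) (x : E) :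
    ‖A x‖ ≤ A.singularValues 0 * ‖x‖ := by
  refine le_of_sq_le_sq ?_ (mul_nonneg (A.singularValues_nonneg _) (norm_nonneg _))
  rw [norm_sq_apply_eq_sum_singularValues hp, mul_pow,
    ← (rightSingularBasis A hp).sum_sq_norm_inner_right x, Finset.mul_sum]
  refine Finset.sum_le_sum fun i _ => ?_
  rw [Real.norm_eq_abs, sq_abs]
  gcongr
  · exact A.singularValues_nonneg _
  · exact A.singularValues_antitone (Nat.zero_le _)

theorem singularValues_last_mul_norm_le (hp : Module.finrank ℝ E = p) (A : E →ₗ[ℝ] E) (x : E) :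
    A.singularValues (p - 1) * ‖x‖ ≤ ‖A x‖ := by
  refine le_of_sq_le_sq ?_ (norm_nonneg _)
  rw [norm_sq_apply_eq_sum_singularValues hp, mul_pow,
    ← (rightSingularBasis A hp).sum_sq_norm_inner_right x, Finset.mul_sum]
  refine Finset.sum_le_sum fun i _ => ?_
  rw [Real.norm_eq_abs, sq_abs]
  gcongr
  · exact A.singularValues_nonneg _
  · exact A.singularValues_antitone (by omega)

theorem exists_norm_apply_eq_singularValues (hp : Module.finrank ℝ E = p) (A : E →ₗ[ℝ] E) {i : ℕ}
    (hi : i < p) : ∃ x, ‖x‖ = 1 ∧ ‖A x‖ = A.singularValues i :=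
  ⟨rightSingularBasis A hp ⟨i, hi⟩, by simp, norm_apply_rightSingularBasis hp A ⟨i, hi⟩⟩

theorem hsInner_self_eq_sum_singularValues (hp : Module.finrank ℝ E = p) (A : E →ₗ[ℝ] E) :
    hsInner A A = ∑ i : Fin p, A.singularValues i ^ 2 := by
  rw [← sum_norm_sq_eq_hsInner (rightSingularBasis A hp)]
  simp_rw [norm_apply_rightSingularBasis]

theorem singularValues_last_mul_norm_sq_le_inner (hp : Module.finrank ℝ E = p) (A : E →ₗ[ℝ] E)
    (hA : A.IsSymmetric) (hpos : ∀ x, 0 ≤ ⟪x, A x⟫) (x : E) :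
    A.singularValues (p - 1) * ‖x‖ ^ 2 ≤ ⟪x, A x⟫ := by
  set e := hA.eigenvectorBasis hp
  have he : ∀ i, A (e i) = hA.eigenvalues hp i • e i := hA.apply_eigenvectorBasis hp
  rw [← e.sum_inner_mul_inner, ← e.sum_sq_norm_inner_right x, Finset.mul_sum]
  refine Finset.sum_le_sum fun i _ => ?_
  have h1 : A.singularValues (p - 1) ≤ hA.eigenvalues hp i := by
    have h2 := singularValues_last_mul_norm_le hp A (e i)
    have h3 := hpos (e i)
    rw [he, real_inner_smul_right, real_inner_self_eq_norm_sq, e.norm_eq_one] at h3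
    rw [he, norm_smul, e.norm_eq_one, Real.norm_eq_abs, abs_of_nonneg (by linarith)] at h2
    linarith
  rw [← hA, he, real_inner_smul_left, real_inner_comm x, Real.norm_eq_abs, sq_abs]
  nlinarith [sq_nonneg ⟪e i, x⟫]

theorem norm_adjoint_apply_le {A : E →ₗ[ℝ] E} {c : ℝ} (h : ∀ x, ‖A x‖ ≤ c * ‖x‖) (x : E) :
    ‖A.adjoint x‖ ≤ c * ‖x‖ := by
  have h1 : ‖A.adjoint x‖ ^ 2 ≤ c * ‖A.adjoint x‖ * ‖x‖ := by
    rw [← real_inner_self_eq_norm_sq, LinearMap.adjoint_inner_right]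
    exact (real_inner_le_norm _ _).trans (mul_le_mul_of_nonneg_right (h _) (norm_nonneg _))
  rcases (norm_nonneg (A.adjoint x)).eq_or_lt with h0 | h0
  · rw [← h0]
    exact (norm_nonneg _).trans (h x)
  · nlinarith

end SingularValueBounds

/-! ### Consequences of the discrete Lyapunov equation. -/

noncomputable section StationaryCovariance

open scoped RealInnerProductSpace

variable {E : Type*} [NormedAddCommGroup E] [InnerProductSpace ℝ E] [FiniteDimensional ℝ E]

/-- `S` solves the discrete Lyapunov equation of the stable system matrix `T`. -/
structure IsLyapunovSolution (T S : E →ₗ[ℝ] E) (γ ν : ℝ) : Prop where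
  norm_le : ∀ x, ‖T x‖ ≤ γ * ‖x‖
  nonneg : 0 ≤ γ
  lt_one : γ < 1
  eq : ∀ x, S x = T (S (T.adjoint x)) + ν ^ 2 • x

namespace IsLyapunovSolution

variable {T S : E →ₗ[ℝ] E} {γ ν : ℝ} (h : IsLyapunovSolution T S γ ν)
include h

theorem norm_adjoint_pow_le (k : ℕ) (x : E) : ‖(T.adjoint ^ k) x‖ ≤ γ ^ k * ‖x‖ := by
  induction k with
  | zero => simp
  | succ k ih =>
    rw [pow_succ' T.adjoint k, Module.End.mul_apply]
    calc ‖T.adjoint ((T.adjoint ^ k) x)‖ ≤ γ * ‖(T.adjoint ^ k) x‖ :=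
          norm_adjoint_apply_le h.norm_le _
      _ ≤ γ * (γ ^ k * ‖x‖) := mul_le_mul_of_nonneg_left ih h.nonneg
      _ = γ ^ (k + 1) * ‖x‖ := by ring

theorem tendsto_adjoint_pow (x : E) :
    Filter.Tendsto (fun k => (T.adjoint ^ k) x) Filter.atTop (nhds 0) := by
  refine squeeze_zero_norm (fun k => h.norm_adjoint_pow_le k x) ?_
  simpa using (tendsto_pow_atTop_nhds_zero_of_lt_one h.nonneg h.lt_one).mul_const ‖x‖

theorem inner_eq (x y : E) :
    ⟪x, S y⟫ = ⟪T.adjoint x, S (T.adjoint y)⟫ + ν ^ 2 * ⟪x, y⟫ := by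
  rw [h.eq, inner_add_right, real_inner_smul_right, LinearMap.adjoint_inner_left]

theorem tendsto_inner_adjoint_pow (x y : E) :
    Filter.Tendsto (fun k => ⟪(T.adjoint ^ k) x, S ((T.adjoint ^ k) y)⟫) Filter.atTop (nhds 0) := by
  have h1 := h.tendsto_adjoint_pow x
  have h2 := (S.continuous_of_finiteDimensional.tendsto 0).comp (h.tendsto_adjoint_pow y)
  rw [map_zero] at h2
  simpa using h1.inner (𝕜 := ℝ) h2

/-- The antisymmetric part of the form of `S` is unchanged when both arguments are moved by the
adjoint of `T`, whose powers tend to zero. -/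
theorem isSymmetric : S.IsSymmetric := by
  intro x y
  have hk : ∀ k : ℕ, ⟪x, S y⟫ - ⟪y, S x⟫ =
      ⟪(T.adjoint ^ k) x, S ((T.adjoint ^ k) y)⟫ -
        ⟪(T.adjoint ^ k) y, S ((T.adjoint ^ k) x)⟫ := by
    intro k
    induction k with
    | zero => simp
    | succ k ih =>
      rw [ih, h.inner_eq ((T.adjoint ^ k) x), h.inner_eq ((T.adjoint ^ k) y), pow_succ' T.adjoint k,
        real_inner_comm ((T.adjoint ^ k) x)]
      simp
  have hlim := (h.tendsto_inner_adjoint_pow x y).sub (h.tendsto_inner_adjoint_pow y x)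
  simp only [← hk, sub_zero] at hlim
  have := tendsto_nhds_unique tendsto_const_nhds hlim
  rw [real_inner_comm]
  linarith

theorem inner_nonneg (x : E) : 0 ≤ ⟪x, S x⟫ := by
  have hk : ∀ k : ℕ, ⟪(T.adjoint ^ k) x, S ((T.adjoint ^ k) x)⟫ ≤ ⟪x, S x⟫ := by
    intro k
    induction k with
    | zero => simp
    | succ k ih =>
      refine le_trans ?_ ih
      rw [h.inner_eq ((T.adjoint ^ k) x), pow_succ' T.adjoint k, Module.End.mul_apply,
        real_inner_self_eq_norm_sq]
      nlinarith [sq_nonneg ν, sq_nonneg ‖(T.adjoint ^ k) x‖,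
        mul_nonneg (sq_nonneg ν) (sq_nonneg ‖(T.adjoint ^ k) x‖)]
  exact le_of_tendsto (h.tendsto_inner_adjoint_pow x x) (Filter.Eventually.of_forall hk)

theorem sq_mul_norm_sq_le_inner (x : E) : ν ^ 2 * ‖x‖ ^ 2 ≤ ⟪x, S x⟫ := by
  rw [h.inner_eq x x, real_inner_self_eq_norm_sq]
  linarith [h.inner_nonneg (T.adjoint x)]

variable {p : ℕ}

theorem sq_le_singularValues_last (hp : Module.finrank ℝ E = p) (hp0 : 0 < p) :
    ν ^ 2 ≤ S.singularValues (p - 1) := by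
  obtain ⟨x, hx, hSx⟩ := exists_norm_apply_eq_singularValues hp S (i := p - 1) (by omega)
  have h1 := h.sq_mul_norm_sq_le_inner x
  have h2 := real_inner_le_norm x (S x)
  rw [hx, hSx] at h2
  rw [hx] at h1
  linarith

/-- Take norms in the Lyapunov equation at a unit vector where `S` attains its norm. Bounding
`σ_max(Σ)` by the innovation variance later keeps condition numbers out of the curvature event. -/
theorem one_sub_sq_mul_singularValues_zero_le (hp : Module.finrank ℝ E = p) (hp0 : 0 < p) :
    (1 - γ ^ 2) * S.singularValues 0 ≤ ν ^ 2 := by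
  obtain ⟨x, hx, hSx⟩ := exists_norm_apply_eq_singularValues hp S (i := 0) hp0
  have h1 : ‖S x‖ ≤ γ * (S.singularValues 0 * (γ * ‖x‖)) + ν ^ 2 * ‖x‖ := by
    rw [h.eq]
    refine (norm_add_le _ _).trans (add_le_add ((h.norm_le _).trans ?_) ?_)
    · refine mul_le_mul_of_nonneg_left ?_ h.nonneg
      refine (norm_apply_le_singularValues_zero hp S _).trans ?_
      exact mul_le_mul_of_nonneg_left (norm_adjoint_apply_le h.norm_le x)
        (S.singularValues_nonneg _)
    · rw [norm_smul, Real.norm_eq_abs, abs_of_nonneg (sq_nonneg ν)]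
  rw [hx, hSx] at h1
  linarith

end IsLyapunovSolution

end StationaryCovariance

/-! ### From matrices to endomorphisms of Euclidean space. -/

noncomputable section Translation

open scoped RealInnerProductSpace

variable {p : ℕ}

theorem nuclearNorm_eq_nuc (A : Matrix (Fin p) (Fin p) ℝ) :
    nuclearNorm A = nuc (Matrix.toEuclideanLin A) p := by
  rw [nuclearNorm, nuc, Finset.sum_range]
  rfl

theorem adjoint_toEuclideanLin (A : Matrix (Fin p) (Fin p) ℝ) :
    (Matrix.toEuclideanLin A).adjoint = Matrix.toEuclideanLin A.transpose := by
  rw [← Matrix.conjTranspose_eq_transpose_of_trivial, Matrix.toEuclideanLin_conjTranspose_eq_adjoint]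

theorem toEuclideanLin_mul_apply (A B : Matrix (Fin p) (Fin p) ℝ) (x : EuclideanSpace ℝ (Fin p)) :
    Matrix.toEuclideanLin (A * B) x = Matrix.toEuclideanLin A (Matrix.toEuclideanLin B x) := by
  simp [Matrix.toEuclideanLin, Matrix.toLpLin_apply]

theorem frobNorm_sq (A : Matrix (Fin p) (Fin p) ℝ) :
    frobNorm A ^ 2 = hsInner (Matrix.toEuclideanLin A) (Matrix.toEuclideanLin A) := by
  have h : Matrix.trace (A.transpose * A) =
      hsInner (Matrix.toEuclideanLin A) (Matrix.toEuclideanLin A) := by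
    rw [← sum_norm_sq_eq_hsInner (EuclideanSpace.basisFun (Fin p) ℝ), Matrix.trace]
    refine Finset.sum_congr rfl fun j _ => ?_
    rw [EuclideanSpace.norm_sq_eq]
    simp [Matrix.mul_apply, sq, Matrix.toLpLin_apply]
  rw [frobNorm, Real.sq_sqrt (h ▸ hsInner_self_nonneg _), h]

theorem isLyapunovSolution_toEuclideanLin {Θ S : Matrix (Fin p) (Fin p) ℝ} {γ ν : ℝ}
    (hΘ : sigmaMax Θ ≤ γ) (hγ : γ < 1)
    (hS : S = Θ * S * Θ.transpose + ν ^ 2 • (1 : Matrix (Fin p) (Fin p) ℝ)) :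
    IsLyapunovSolution (Matrix.toEuclideanLin Θ) (Matrix.toEuclideanLin S) γ ν where
  norm_le x := (norm_apply_le_singularValues_zero finrank_euclideanSpace_fin _ x).trans
    (mul_le_mul_of_nonneg_right hΘ (norm_nonneg x))
  nonneg := ((Matrix.toEuclideanLin Θ).singularValues_nonneg 0).trans hΘ
  lt_one := hγ
  eq x := by
    conv_lhs => rw [hS]
    rw [adjoint_toEuclideanLin, ← toEuclideanLin_mul_apply, ← toEuclideanLin_mul_apply, map_add,
      LinearMap.add_apply, map_smul, Matrix.mul_assoc]
    simp [Matrix.toLpLin_one]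

end Translation

/-! ### Nets of the sphere and discretized operator norms. -/

noncomputable section Nets

open scoped RealInnerProductSpace Function ENNReal

variable {E : Type*} [NormedAddCommGroup E] [InnerProductSpace ℝ E] [FiniteDimensional ℝ E]

-- Volume comparison: disjoint balls of radius `1/8` about the points lie in the ball of radius
-- `9/8`.
open Metric Module in
theorem card_le_of_quarter_separated (s : Finset E) (hs : ∀ c ∈ s, ‖c‖ = 1)
    (h : ∀ c ∈ s, ∀ d ∈ s, c ≠ d → 1 / 4 ≤ ‖c - d‖) : s.card ≤ 9 ^ finrank ℝ E := by
  borelize E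
  let μ : Measure E := Measure.addHaar
  let δ : ℝ := (1 : ℝ) / 8
  let ρ : ℝ := (9 : ℝ) / 8
  have ρpos : 0 < ρ := by norm_num [ρ]
  have δpos : 0 < δ := by norm_num [δ]
  set A := ⋃ c ∈ s, ball (c : E) δ with hA
  have D : Set.Pairwise (s : Set E) (Disjoint on fun c => ball (c : E) δ) := by
    rintro c hc d hd hcd
    apply ball_disjoint_ball
    rw [dist_eq_norm]
    refine le_trans ?_ (h c hc d hd hcd)
    norm_num [δ]
  have A_subset : A ⊆ ball (0 : E) ρ := by
    refine Set.iUnion₂_subset fun x hx => ball_subset_ball' ?_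
    rw [dist_zero_right, hs x hx]
    norm_num [δ, ρ]
  have I : (s.card : ℝ≥0∞) * ENNReal.ofReal (δ ^ finrank ℝ E) * μ (ball 0 1) ≤
      ENNReal.ofReal (ρ ^ finrank ℝ E) * μ (ball 0 1) :=
    calc
      (s.card : ℝ≥0∞) * ENNReal.ofReal (δ ^ finrank ℝ E) * μ (ball 0 1) = μ A := by
        rw [hA, measure_biUnion_finset D fun c _ => measurableSet_ball]
        simp only [μ.addHaar_ball_of_pos _ δpos]
        simp only [Finset.sum_const, nsmul_eq_mul, mul_assoc]
      _ ≤ μ (ball (0 : E) ρ) := measure_mono A_subset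
      _ = ENNReal.ofReal (ρ ^ finrank ℝ E) * μ (ball 0 1) := by
        simp only [μ.addHaar_ball_of_pos _ ρpos]
  have J : (s.card : ℝ≥0∞) * ENNReal.ofReal (δ ^ finrank ℝ E) ≤
      ENNReal.ofReal (ρ ^ finrank ℝ E) :=
    (ENNReal.mul_le_mul_iff_left (measure_ball_pos _ _ zero_lt_one).ne' measure_ball_lt_top.ne).1 I
  have K : (s.card : ℝ) * δ ^ finrank ℝ E ≤ ρ ^ finrank ℝ E := by
    have := ENNReal.toReal_le_of_le_ofReal (pow_nonneg ρpos.le _) J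
    rwa [ENNReal.toReal_mul, ENNReal.toReal_ofReal (by positivity), ENNReal.toReal_natCast] at this
  have hρ : ρ = 9 * δ := by norm_num [ρ, δ]
  rw [hρ, mul_pow] at K
  exact_mod_cast le_of_mul_le_mul_right K (by positivity)

variable (E) in
/-- The unit sphere has a `1 / 4`-net of cardinality at most `9 ^ dim`. -/
theorem exists_quarter_net : ∃ s : Finset E, s.card ≤ 9 ^ Module.finrank ℝ E ∧
    (∀ x ∈ s, ‖x‖ = 1) ∧ ∀ x : E, ‖x‖ = 1 → ∃ y ∈ s, ‖x - y‖ ≤ 1 / 4 := by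
  classical
  let P : ℕ → Prop := fun k => ∃ s : Finset E, s.card = k ∧ (∀ c ∈ s, ‖c‖ = 1) ∧
    ∀ c ∈ s, ∀ d ∈ s, c ≠ d → 1 / 4 ≤ ‖c - d‖
  have hP0 : P 0 := ⟨∅, by simp⟩
  -- A separated set of maximal cardinality is a net, since a point far from it could be added.
  obtain ⟨s, hcard, hs, hsep⟩ := Nat.findGreatest_spec (P := P)
    (Nat.zero_le (9 ^ Module.finrank ℝ E)) hP0
  refine ⟨s, card_le_of_quarter_separated s hs hsep, hs, fun x hx => ?_⟩
  by_contra! hfar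
  have hxs : x ∉ s := fun hmem => by
    have := hfar x hmem
    rw [sub_self, norm_zero] at this
    norm_num at this
  have hP : P (s.card + 1) := by
    refine ⟨insert x s, Finset.card_insert_of_notMem hxs, ?_, ?_⟩
    · simpa [hx] using hs
    · intro c hc d hd hcd
      rcases Finset.mem_insert.1 hc with rfl | hc' <;> rcases Finset.mem_insert.1 hd with rfl | hd'
      · exact absurd rfl hcd
      · exact (hfar d hd').le
      · rw [norm_sub_rev]
        exact (hfar c hc').le
      · exact hsep c hc' d hd' hcd
  have hle : s.card + 1 ≤ 9 ^ Module.finrank ℝ E := by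
    obtain ⟨t, ht, ht1, ht2⟩ := hP
    rw [← ht]
    exact card_le_of_quarter_separated t ht1 ht2
  have := Nat.le_findGreatest hle hP
  omega

/-- Moving a maximizing pair to the net costs at most a quarter of the norm `d` for each vector, so
`d ≤ a + d/2`. -/
theorem norm_apply_le_of_net {s : Finset E}
    (hnet : ∀ x : E, ‖x‖ = 1 → ∃ y ∈ s, ‖x - y‖ ≤ 1 / 4) (hs : ∀ x ∈ s, ‖x‖ = 1)
    (hE : 0 < Module.finrank ℝ E) (N : E →ₗ[ℝ] E) {a : ℝ} (ha : 0 ≤ a)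
    (h : ∀ u ∈ s, ∀ v ∈ s, ⟪u, N v⟫ ≤ a) (x : E) : ‖N x‖ ≤ 2 * a * ‖x‖ := by
  set d := N.singularValues 0 with hd
  have hN : ∀ x, ‖N x‖ ≤ d * ‖x‖ := norm_apply_le_singularValues_zero rfl N
  obtain ⟨v₀, hv₀, hNv₀⟩ := exists_norm_apply_eq_singularValues rfl N hE
  suffices hda : d ≤ 2 * a from (hN x).trans (mul_le_mul_of_nonneg_right hda (norm_nonneg _))
  rcases (N.singularValues_nonneg 0).eq_or_lt with h0 | h0
  · rw [hd, ← h0]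
    positivity
  set u₀ := d⁻¹ • N v₀ with hu₀_def
  have hu₀ : ‖u₀‖ = 1 := by
    rw [hu₀_def, norm_smul, hNv₀, Real.norm_eq_abs, abs_inv, abs_of_pos h0]
    exact inv_mul_cancel₀ h0.ne'
  have hpair : ⟪u₀, N v₀⟫ = d := by
    rw [hu₀_def, real_inner_smul_left, real_inner_self_eq_norm_sq, hNv₀, ← hd, sq, ← mul_assoc,
      inv_mul_cancel₀ h0.ne', one_mul]
  obtain ⟨u, hu, hu'⟩ := hnet u₀ hu₀
  obtain ⟨v, hv, hv'⟩ := hnet v₀ hv₀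
  have h1 : ⟪u₀ - u, N v₀⟫ ≤ 1 / 4 * d := (real_inner_le_norm _ _).trans (by rw [hNv₀]; gcongr)
  have h2 : ⟪u, N (v₀ - v)⟫ ≤ d * (1 / 4) := by
    refine (real_inner_le_norm _ _).trans ?_
    rw [hs u hu, one_mul]
    exact (hN _).trans (mul_le_mul_of_nonneg_left hv' h0.le)
  have h3 : ⟪u₀, N v₀⟫ = ⟪u₀ - u, N v₀⟫ + ⟪u, N (v₀ - v)⟫ + ⟪u, N v⟫ := by
    rw [inner_sub_left, map_sub, inner_sub_right]
    ring
  linarith [h u hu v hv]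

/-- For a symmetric operator one net vector suffices: move the top eigenvector, and use that the
difference of the quadratic forms at `e` and `u` is `⟪e - u, A (e + u)⟫`. -/
theorem norm_apply_le_of_net_of_isSymmetric {s : Finset E}
    (hnet : ∀ x : E, ‖x‖ = 1 → ∃ y ∈ s, ‖x - y‖ ≤ 1 / 4) (hs : ∀ x ∈ s, ‖x‖ = 1)
    (hE : 0 < Module.finrank ℝ E) (A : E →ₗ[ℝ] E) (hA : A.IsSymmetric) {a : ℝ}
    (h : ∀ u ∈ s, |⟪u, A u⟫| ≤ a) (x : E) : ‖A x‖ ≤ 2 * a * ‖x‖ := by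
  set e := hA.eigenvectorBasis rfl
  have he : ∀ i, A (e i) = hA.eigenvalues rfl i • e i := hA.apply_eigenvectorBasis rfl
  have : Nonempty (Fin (Module.finrank ℝ E)) := ⟨⟨0, hE⟩⟩
  obtain ⟨i, hi⟩ := Finite.exists_max fun i => |hA.eigenvalues rfl i|
  set m := |hA.eigenvalues rfl i| with hm
  have hnorm : ∀ x, ‖A x‖ ≤ m * ‖x‖ := fun x => by
    refine le_of_sq_le_sq ?_ (mul_nonneg (abs_nonneg _) (norm_nonneg _))
    rw [mul_pow, ← e.sum_sq_norm_inner_right x, ← e.sum_sq_norm_inner_right (A x), Finset.mul_sum]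
    refine Finset.sum_le_sum fun j _ => ?_
    rw [← hA, he, real_inner_smul_left, norm_mul, mul_pow, Real.norm_eq_abs]
    gcongr
    exact hi j
  have hei : |⟪e i, A (e i)⟫| = m := by
    rw [he, real_inner_smul_right, real_inner_self_eq_norm_sq, e.norm_eq_one]
    simp [hm]
  obtain ⟨u, hu, hu'⟩ := hnet (e i) (e.norm_eq_one i)
  have h1 : ⟪e i, A (e i)⟫ = ⟪u, A u⟫ + ⟪e i - u, A (e i + u)⟫ := by
    rw [map_add, inner_sub_left, inner_add_right, inner_add_right, ← hA u (e i),
      real_inner_comm (e i) (A u)]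
    ring
  have h2 : |⟪e i - u, A (e i + u)⟫| ≤ 1 / 4 * (m * 2) := by
    refine (abs_real_inner_le_norm _ _).trans (mul_le_mul hu' ((hnorm _).trans ?_)
      (norm_nonneg _) (by norm_num))
    refine mul_le_mul_of_nonneg_left ?_ (abs_nonneg _)
    refine (norm_add_le _ _).trans ?_
    rw [e.norm_eq_one, hs u hu]
    norm_num
  have h3 : m ≤ 2 * a := by
    have := abs_add_le ⟪u, A u⟫ ⟪e i - u, A (e i + u)⟫
    rw [← h1, hei] at this
    linarith [h u hu]
  exact (hnorm x).trans (mul_le_mul_of_nonneg_right h3 (norm_nonneg x))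

end Nets

/-! ### Exponential tails of Gaussian sums of squares. -/

noncomputable section GaussianQuadraticForms

open scoped RealInnerProductSpace NNReal ENNReal
open Real (exp)

/-- This is `-log (1 - x) ≤ x + x²`. Since `(1 - x)(1 + x + x²) = 1 - x³`, the linear lower bound
for `exp` suffices only for `x ≤ 0`; the other half needs the quadratic one. -/
theorem one_le_one_sub_mul_exp {x : ℝ} (hx : |x| ≤ 1 / 2) : 1 ≤ (1 - x) * exp (x + x ^ 2) := by
  obtain ⟨h1, h2⟩ := abs_le.1 hx
  have h3 : 0 < 1 - x := by linarith
  rcases le_total 0 x with h | h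
  · have h4 := Real.quadratic_le_exp_of_nonneg (x := x + x ^ 2) (by positivity)
    have h5 : 1 ≤ (1 - x) * (1 + (x + x ^ 2) + (x + x ^ 2) ^ 2 / 2) := by
      nlinarith [mul_nonneg (sq_nonneg x) h, mul_nonneg (sq_nonneg x) (sub_nonneg.2 h2),
        mul_nonneg (mul_nonneg (sq_nonneg x) h) h, mul_nonneg (mul_nonneg (sq_nonneg x) h)
        (sub_nonneg.2 h2), mul_nonneg (mul_nonneg (mul_nonneg (sq_nonneg x) h) h) (sub_nonneg.2 h2)]
    exact h5.trans (mul_le_mul_of_nonneg_left h4 h3.le)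
  · have h4 := Real.add_one_le_exp (x + x ^ 2)
    have h5 : 1 ≤ (1 - x) * (x + x ^ 2 + 1) := by
      nlinarith [mul_nonneg (sq_nonneg x) (neg_nonneg.2 h)]
    exact h5.trans (mul_le_mul_of_nonneg_left h4 h3.le)

theorem inv_sqrt_one_sub_le {x : ℝ} (hx : |x| ≤ 1 / 2) :
    (√(1 - x))⁻¹ ≤ exp (x / 2 + x ^ 2 / 2) := by
  have h3 : 0 < 1 - x := by linarith [(abs_le.1 hx).2]
  have h4 : exp (x / 2 + x ^ 2 / 2) = √(exp (x + x ^ 2)) := by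
    rw [← Real.exp_half]
    ring_nf
  rw [h4, inv_le_iff_one_le_mul₀' (Real.sqrt_pos.2 h3), ← Real.sqrt_mul h3.le]
  exact Real.one_le_sqrt.2 (one_le_one_sub_mul_exp hx)

theorem integral_exp_mul_sq_gaussianReal {v : ℝ≥0} (hv : v ≠ 0) {t : ℝ} (ht : 2 * t * v < 1) :
    ∫ y, exp (t * y ^ 2) ∂(gaussianReal 0 v) = (√(1 - 2 * t * v))⁻¹ := by
  have hv' : (0 : ℝ) < v := NNReal.coe_pos.2 (pos_iff_ne_zero.2 hv)
  rw [integral_gaussianReal_eq_integral_smul hv]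
  have h1 : ∀ y : ℝ, gaussianPDFReal 0 v y • exp (t * y ^ 2) =
      (√(2 * Real.pi * v))⁻¹ * exp (-((1 - 2 * t * v) / (2 * v)) * y ^ 2) := fun y => by
    rw [gaussianPDFReal_def, smul_eq_mul, mul_assoc, ← Real.exp_add]
    congr 2
    field_simp
    ring
  simp_rw [h1]
  rw [integral_const_mul, integral_gaussian, ← Real.sqrt_inv, ← Real.sqrt_inv,
    ← Real.sqrt_mul (by positivity)]
  congr 1
  have : 1 - 2 * t * v ≠ 0 := by linarith
  have := Real.pi_pos.ne'
  field_simp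

theorem integrable_exp_mul_sq_gaussianReal {v : ℝ≥0} {t : ℝ} (ht : |t| * v ≤ 1 / 4) :
    Integrable (fun y => exp (t * y ^ 2)) (gaussianReal 0 v) := by
  rcases eq_or_ne v 0 with rfl | hv
  · rw [gaussianReal_zero_var]
    exact integrable_dirac (by simp)
  · have h1 : 2 * t * v < 1 := by nlinarith [le_abs_self t, v.2]
    -- The integral of a nonintegrable function is `0` by convention, whereas the formula gives a
    -- positive value.
    by_contra h
    have h2 := integral_exp_mul_sq_gaussianReal hv h1
    rw [integral_undef h] at h2
    have : 0 < (√(1 - 2 * t * v))⁻¹ := inv_pos.2 (Real.sqrt_pos.2 (by linarith))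
    linarith

theorem integral_exp_mul_sq_gaussianReal_le {v : ℝ≥0} {t : ℝ} (ht : |t| * v ≤ 1 / 4) :
    ∫ y, exp (t * y ^ 2) ∂(gaussianReal 0 v) ≤ exp (t * v + 2 * t ^ 2 * v ^ 2) := by
  rcases eq_or_ne v 0 with rfl | hv
  · simp [gaussianReal_zero_var]
  · have h1 : 2 * t * v < 1 := by nlinarith [le_abs_self t, v.2]
    rw [integral_exp_mul_sq_gaussianReal hv h1]
    refine (inv_sqrt_one_sub_le ?_).trans_eq ?_
    · rw [abs_mul, abs_mul, abs_two, NNReal.abs_eq]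
      linarith
    · ring_nf

variable {Ω : Type*} [MeasurableSpace Ω] {μ : Measure Ω} [IsProbabilityMeasure μ] {n : ℕ}

/-- A centred Gaussian vector has independent coordinates in a suitable orthonormal basis. -/
theorem exists_iIndepFun_rotation {X : Fin n → Ω → ℝ}
    (hX : HasGaussianLaw (fun ω i => X i ω) μ) (h0 : ∀ i, ∫ ω, X i ω ∂μ = 0) :
    ∃ b : OrthonormalBasis (Fin n) ℝ (EuclideanSpace ℝ (Fin n)),
      iIndepFun (fun i ω => ∑ j, b i j * X j ω) μ ∧
      ∀ i, μ.map (fun ω => ∑ j, b i j * X j ω) =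
        gaussianReal 0 (Var[fun ω => ∑ j, b i j * X j ω; μ]).toNNReal := by
  set C : Matrix (Fin n) (Fin n) ℝ := Matrix.of fun i j => cov[X i, X j; μ] with hC_def
  have hC : C.IsHermitian := by
    ext i j
    simp [C, covariance_comm (X i)]
  have hL2 : ∀ i, MemLp (X i) 2 μ := fun i => (hX.eval i).memLp_two
  have hL2' : ∀ (c : ℝ) i, MemLp (fun ω => c * X i ω) 2 μ := fun c i => (hL2 i).const_mul c
  set b := hC.eigenvectorBasis with hb
  have hlin : ∀ c : Fin n → ℝ, HasGaussianLaw (fun ω => ∑ j, c j * X j ω) μ := fun c => by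
    have := hX.map_fun (∑ j, c j • ContinuousLinearMap.proj (R := ℝ) (φ := fun _ : Fin n => ℝ) j)
    simpa [sum_apply] using this
  refine ⟨b, ?_, fun i => ?_⟩
  · refine HasGaussianLaw.iIndepFun_of_covariance_eq_zero ?_ fun i k hik => ?_
    · have := hX.map_fun (ContinuousLinearMap.pi fun i => ∑ j, b i j •
        ContinuousLinearMap.proj (R := ℝ) (φ := fun _ : Fin n => ℝ) j)
      simpa [sum_apply] using this
    · rw [covariance_fun_sum_fun_sum (fun j => hL2' _ j) (fun j => hL2' _ j)]
      simp_rw [covariance_const_mul_left, covariance_const_mul_right]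
      have h1 : ∑ j, ∑ l, b i j * (b k l * cov[X j, X l; μ]) =
          ∑ j, b i j * (C.mulVec (b k)) j := by
        refine Finset.sum_congr rfl fun j _ => ?_
        rw [Matrix.mulVec, dotProduct, Finset.mul_sum]
        exact Finset.sum_congr rfl fun l _ => by rw [hC_def, Matrix.of_apply]; ring
      have h2 := hC.mulVec_eigenvectorBasis k
      rw [← hb] at h2
      rw [h1, h2]
      have h3 := b.inner_eq_ite i k
      rw [if_neg hik, PiLp.inner_apply] at h3
      simp only [RCLike.inner_apply, conj_trivial] at h3
      calc ∑ j, b i j * (hC.eigenvalues k • (b k : Fin n → ℝ)) j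
          = hC.eigenvalues k * ∑ j, b k j * b i j := by
            rw [Finset.mul_sum]
            exact Finset.sum_congr rfl fun j _ => by simp; ring
        _ = 0 := by rw [h3, mul_zero]
  · rw [(hlin _).map_eq_gaussianReal]
    congr 1
    rw [integral_finsetSum _ fun j _ => ((hX.eval j).integrable).const_mul _]
    simp [integral_const_mul, h0]

/-- `X` is a centred Gaussian vector whose covariance matrix is at most `L` times the identity. -/
structure IsGaussianWithCovLE (X : Fin n → Ω → ℝ) (μ : Measure Ω) (L : ℝ) : Prop where
  gaussian : HasGaussianLaw (fun ω i => X i ω) μ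
  centred : ∀ i, ∫ ω, X i ω ∂μ = 0
  variance_le : ∀ a : Fin n → ℝ, Var[fun ω => ∑ j, a j * X j ω; μ] ≤ L * ∑ j, a j ^ 2

namespace IsGaussianWithCovLE

variable {X : Fin n → Ω → ℝ} {L : ℝ} (h : IsGaussianWithCovLE X μ L)
include h

omit [IsProbabilityMeasure μ] in
theorem mono {L' : ℝ} (hL : L ≤ L') : IsGaussianWithCovLE X μ L' where
  gaussian := h.gaussian
  centred := h.centred
  variance_le a := (h.variance_le a).trans (by gcongr)

/-- In coordinates that diagonalize the covariance the squares are independent and the moment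
generating function factors. Both the sum of squares and the total variance are invariant under the
rotation, and each rotated variance is at most `L`, so their squares sum to at most `L` times the
total. -/
theorem integral_exp_sum_sq {t : ℝ} (ht : |t| * L ≤ 1 / 4) :
    Integrable (fun ω => exp (t * ∑ i, X i ω ^ 2)) μ ∧
    ∫ ω, exp (t * ∑ i, X i ω ^ 2) ∂μ ≤
      exp (t * ∑ i, Var[X i; μ] + 2 * t ^ 2 * L * ∑ i, Var[X i; μ]) := by
  obtain ⟨b, hind, hlaw⟩ := exists_iIndepFun_rotation h.gaussian h.centred
  set Y : Fin n → Ω → ℝ := fun i ω => ∑ j, b i j * X j ω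
  have hmeas : ∀ i, AEMeasurable (Y i) μ := fun i =>
    Finset.aemeasurable_fun_sum _ fun j _ => (h.gaussian.eval j).aemeasurable.const_mul _
  have hsq : ∀ ω, ∑ i, X i ω ^ 2 = ∑ i, Y i ω ^ 2 := fun ω => by
    have h1 := b.sum_sq_norm_inner_right (WithLp.toLp 2 fun j => X j ω)
    rw [EuclideanSpace.norm_sq_eq] at h1
    simp only [PiLp.inner_apply, RCLike.inner_apply, conj_trivial, Real.norm_eq_abs, sq_abs] at h1
    rw [← h1]
    refine Finset.sum_congr rfl fun i _ => ?_
    congr 1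
    exact Finset.sum_congr rfl fun j _ => mul_comm _ _
  have hbnorm : ∀ i, ∑ j, b i j ^ 2 = 1 := fun i => by
    have := b.norm_eq_one i
    rw [EuclideanSpace.norm_eq, Real.sqrt_eq_one] at this
    simpa using this
  have hvle : ∀ i, Var[Y i; μ] ≤ L := fun i => by
    have := h.variance_le fun j => b i j
    rwa [hbnorm, mul_one] at this
  have hvnn : ∀ i, 0 ≤ Var[Y i; μ] := fun i => variance_nonneg _ _
  have hXL2 : ∀ i, MemLp (X i) 2 μ := fun i => (h.gaussian.eval i).memLp_two
  have hYL2 : ∀ i, MemLp (Y i) 2 μ := fun i =>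
    memLp_finsetSum _ fun j _ => (hXL2 j).const_mul _
  have hY0 : ∀ i, ∫ ω, Y i ω ∂μ = 0 := fun i => by
    rw [integral_finsetSum _ fun j _ => ((h.gaussian.eval j).integrable).const_mul _]
    simp [integral_const_mul, h.centred]
  have hvar : ∑ i, Var[X i; μ] = ∑ i, Var[Y i; μ] := by
    have e1 : ∀ i, Var[X i; μ] = ∫ ω, X i ω ^ 2 ∂μ := fun i =>
      variance_of_integral_eq_zero (hXL2 i).aemeasurable (h.centred i)
    have e2 : ∀ i, Var[Y i; μ] = ∫ ω, Y i ω ^ 2 ∂μ := fun i =>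
      variance_of_integral_eq_zero (hYL2 i).aemeasurable (hY0 i)
    simp_rw [e1, e2]
    rw [← integral_finsetSum _ fun i _ => (hXL2 i).integrable_sq,
      ← integral_finsetSum _ fun i _ => (hYL2 i).integrable_sq]
    exact integral_congr_ae (Filter.Eventually.of_forall hsq)
  have hsmall : ∀ i, |t| * (Var[Y i; μ]).toNNReal ≤ 1 / 4 := fun i => by
    rw [Real.coe_toNNReal _ (hvnn i)]
    exact (mul_le_mul_of_nonneg_left (hvle i) (abs_nonneg t)).trans ht
  have hmap : ∀ i, μ.map (Y i) = gaussianReal 0 (Var[Y i; μ]).toNNReal := hlaw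
  have hint : ∀ i, Integrable (fun ω => exp (t * Y i ω ^ 2)) μ := fun i => by
    have h1 := integrable_exp_mul_sq_gaussianReal (hsmall i)
    rw [← hmap i] at h1
    exact h1.comp_aemeasurable (hmeas i)
  have hle : ∀ i, ∫ ω, exp (t * Y i ω ^ 2) ∂μ ≤
      exp (t * Var[Y i; μ] + 2 * t ^ 2 * Var[Y i; μ] ^ 2) := fun i => by
    have h1 := integral_exp_mul_sq_gaussianReal_le (hsmall i)
    rwa [← hmap i, integral_map (hmeas i) (by fun_prop), Real.coe_toNNReal _ (hvnn i)] at h1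
  have hind' : iIndepFun (fun i ω => Y i ω ^ 2) μ :=
    hind.comp (fun _ y => y ^ 2) fun _ => by fun_prop
  have hmeas' : ∀ i, AEMeasurable (fun ω => Y i ω ^ 2) μ := fun i => (hmeas i).pow_const 2
  have hexp : ∀ ω, exp (t * ∑ i, X i ω ^ 2) = ∏ i, exp (t * Y i ω ^ 2) := fun ω => by
    rw [hsq, Finset.mul_sum, Real.exp_sum]
  have hmgf := hind'.mgf_sum₀ hmeas' (t := t) Finset.univ
  simp only [mgf, Finset.sum_apply] at hmgf
  simp_rw [hsq]
  constructor
  · refine Integrable.of_integral_ne_zero ?_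
    rw [hmgf]
    exact Finset.prod_ne_zero_iff.2 fun i _ => (integral_exp_pos (hint i)).ne'
  · rw [hmgf, hvar]
    refine (Finset.prod_le_prod (fun i _ => integral_nonneg fun _ => (Real.exp_pos _).le)
      fun i _ => hle i).trans ?_
    rw [← Real.exp_sum, Finset.sum_add_distrib, ← Finset.mul_sum]
    refine Real.exp_le_exp.2 (add_le_add le_rfl ?_)
    rw [Finset.mul_sum]
    refine Finset.sum_le_sum fun i _ => ?_
    rw [sq (Var[Y i; μ]), ← mul_assoc]
    exact mul_le_mul_of_nonneg_right (mul_le_mul_of_nonneg_left (hvle i) (by positivity)) (hvnn i)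

/-- Chernoff's bound in both directions. The two conditions on `r` are the Gaussian and the
exponential regimes of the tail. -/
theorem measure_sum_sq_tails {V τ r : ℝ} (hL : 0 < L) (hV : 0 < V)
    (hXV : ∑ i, Var[X i; μ] ≤ V) (hτ : 0 ≤ τ) (hr₁ : r ≤ τ ^ 2 / (8 * L * V))
    (hr₂ : r ≤ τ / (8 * L)) :
    μ.real {ω | ∑ i, Var[X i; μ] + τ ≤ ∑ i, X i ω ^ 2} ≤ exp (-r) ∧
    μ.real {ω | ∑ i, X i ω ^ 2 ≤ ∑ i, Var[X i; μ] - τ} ≤ exp (-r) := by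
  -- The exponent `-tτ + 2t²LV` is minimized at `t = τ/(4LV)`; beyond `τ = V` that leaves the
  -- admissible range, and the endpoint `1/(4L)` is used.
  obtain ⟨t, ht0, htL, htr⟩ : ∃ t, 0 ≤ t ∧ t * L ≤ 1 / 4 ∧ -t * τ + 2 * t ^ 2 * L * V ≤ -r := by
    rcases le_total τ V with hle | hle
    · refine ⟨τ / (4 * L * V), by positivity, ?_, ?_⟩
      · have : τ / (4 * L * V) * L = τ / V / 4 := by field_simp
        rw [this]
        linarith [(div_le_one hV).2 hle]
      · have : -(τ / (4 * L * V)) * τ + 2 * (τ / (4 * L * V)) ^ 2 * L * V =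
            -(τ ^ 2 / (8 * L * V)) := by
          field_simp
          ring
        rw [this]
        linarith
    · refine ⟨1 / (4 * L), by positivity, ?_, ?_⟩
      · apply le_of_eq
        field_simp
      · have h1 : -(1 / (4 * L)) * τ + 2 * (1 / (4 * L)) ^ 2 * L * V =
            -(τ / (8 * L)) - (τ - V) / (8 * L) := by
          field_simp
          ring
        have h2 : 0 ≤ (τ - V) / (8 * L) := div_nonneg (by linarith) (by positivity)
        rw [h1]
        linarith
  have hmono : 2 * t ^ 2 * L * ∑ i, Var[X i; μ] ≤ 2 * t ^ 2 * L * V := by gcongr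
  constructor
  · obtain ⟨hint, hle⟩ := h.integral_exp_sum_sq (t := t) (by rwa [abs_of_nonneg ht0])
    refine (measure_ge_le_exp_mul_mgf _ ht0 hint).trans ?_
    refine (mul_le_mul_of_nonneg_left hle (Real.exp_pos _).le).trans ?_
    rw [← Real.exp_add]
    exact Real.exp_le_exp.2 (by linarith)
  · obtain ⟨hint, hle⟩ := h.integral_exp_sum_sq (t := -t) (by rwa [abs_neg, abs_of_nonneg ht0])
    refine (measure_le_le_exp_mul_mgf _ (neg_nonpos.2 ht0) hint).trans ?_
    refine (mul_le_mul_of_nonneg_left hle (Real.exp_pos _).le).trans ?_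
    rw [← Real.exp_add]
    exact Real.exp_le_exp.2 (by rw [neg_sq]; linarith)

end IsGaussianWithCovLE

end GaussianQuadraticForms

/-! ### The stationary law and its covariances. -/

noncomputable section GaussianVAR

open scoped RealInnerProductSpace NNReal ENNReal
open Real (exp)

variable {Ω : Type*} [MeasurableSpace Ω] {μ : Measure Ω} [IsProbabilityMeasure μ] {p : ℕ}

theorem inner_toEuclideanLin (M : Matrix (Fin p) (Fin p) ℝ) (u v : EuclideanSpace ℝ (Fin p)) :
    ⟪u, Matrix.toEuclideanLin M v⟫ = dotProduct (u : Fin p → ℝ) (M.mulVec v) := by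
  rw [PiLp.inner_apply, dotProduct]
  refine Finset.sum_congr rfl fun i _ => ?_
  simp [Matrix.toLpLin_apply, mul_comm]

section Law

variable {X : Ω → EuclideanSpace ℝ (Fin p)} {M : Matrix (Fin p) (Fin p) ℝ}

omit [IsProbabilityMeasure μ] in
theorem hasGaussianLaw_of_map_eq (hlaw : μ.map X = multivariateGaussian 0 M) :
    HasGaussianLaw X μ :=
  ⟨by rw [hlaw]; infer_instance⟩

omit [IsProbabilityMeasure μ] in
theorem hasGaussianLaw_inner {X : Ω → EuclideanSpace ℝ (Fin p)} (hX : HasGaussianLaw X μ)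
    (u : EuclideanSpace ℝ (Fin p)) : HasGaussianLaw (fun ω => ⟪u, X ω⟫) μ :=
  hX.map_fun (innerSL ℝ u)

omit [IsProbabilityMeasure μ] in
theorem integral_inner_of_map_eq (hX : Measurable X) (hlaw : μ.map X = multivariateGaussian 0 M)
    (u : EuclideanSpace ℝ (Fin p)) : ∫ ω, ⟪u, X ω⟫ ∂μ = 0 := by
  have h1 : ∫ x, ⟪u, x⟫ ∂(μ.map X) = ∫ ω, ⟪u, X ω⟫ ∂μ :=
    integral_map hX.aemeasurable (by fun_prop)
  rw [← h1, hlaw]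
  have h2 := (innerSL ℝ u).integral_comp_comm
    (IsGaussian.integrable_id (μ := multivariateGaussian (0 : EuclideanSpace ℝ (Fin p)) M))
  simp only [id, innerSL_apply_apply] at h2
  rw [h2, integral_id_multivariateGaussian, inner_zero_right]

theorem covariance_inner_of_map_eq (hX : Measurable X)
    (hlaw : μ.map X = multivariateGaussian 0 M) (hM : M.PosSemidef)
    (u v : EuclideanSpace ℝ (Fin p)) :
    cov[fun ω => ⟪u, X ω⟫, fun ω => ⟪v, X ω⟫; μ] = ⟪u, Matrix.toEuclideanLin M v⟫ := by
  have : IsProbabilityMeasure (μ.map X) := Measure.isProbabilityMeasure_map hX.aemeasurable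
  rw [inner_toEuclideanLin, ← covarianceBilin_multivariateGaussian (μ := 0) hM u v, ← hlaw,
    covarianceBilin_apply_eq_cov (by rw [hlaw]; exact IsGaussian.memLp_two_id),
    covariance_map (by fun_prop) (by fun_prop) hX.aemeasurable]
  rfl

theorem charFun_map_toEuclideanLin_add {X Y : Ω → EuclideanSpace ℝ (Fin p)} (hX : Measurable X)
    (hY : Measurable Y) (hXY : IndepFun X Y μ) (A : EuclideanSpace ℝ (Fin p) →ₗ[ℝ] _)
    (u : EuclideanSpace ℝ (Fin p)) :
    charFun (μ.map fun ω => A (X ω) + Y ω) u =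
      charFun (μ.map X) (A.adjoint u) * charFun (μ.map Y) u := by
  have hA : Measurable A := A.continuous_of_finiteDimensional.measurable
  have hind : IndepFun (A ∘ X) Y μ := hXY.comp hA measurable_id
  have h1 := congrFun (hind.charFun_map_fun_add_eq_mul (hA.comp hX).aemeasurable hY.aemeasurable) u
  have h2 : charFun (μ.map (A ∘ X)) u = charFun (μ.map X) (A.adjoint u) := by
    rw [← Measure.map_map hA hX, charFun_apply, charFun_apply,
      integral_map hA.aemeasurable (by fun_prop)]
    simp_rw [LinearMap.adjoint_inner_right]
  rw [Pi.mul_apply, h2] at h1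
  exact h1

end Law

namespace IsStationaryGaussianVAR

variable {Θ S : Matrix (Fin p) (Fin p) ℝ} {ν γ : ℝ} {Z W : ℕ → Ω → EuclideanSpace ℝ (Fin p)}
  (h : IsStationaryGaussianVAR μ Θ ν Z W)
include h

omit [IsProbabilityMeasure μ] in
theorem measurable (t : ℕ) : Measurable (Z t) := by
  induction t with
  | zero => exact h.measurable_init
  | succ t ih =>
    have h1 : Z (t + 1) = fun ω => Matrix.toEuclideanLin Θ (Z t ω) + W t ω :=
      funext fun ω => h.recursion t ω
    rw [h1]
    exact ((LinearMap.continuous_of_finiteDimensional _).measurable.comp ih).add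
      (h.measurable_noise t)

omit [IsProbabilityMeasure μ] in
theorem identDistrib (t : ℕ) : IdentDistrib (Z t) (Z 0) μ μ := by
  have := (h.stationary t).comp (u := fun z => z 0) (measurable_pi_apply 0)
  simpa [Function.comp_def] using this

omit [IsProbabilityMeasure μ] in
theorem indepFun_init_noise (t : ℕ) : IndepFun (Z 0) (W t) μ :=
  h.init_indep.comp measurable_id (measurable_pi_apply t)

/-- No Gaussianity of the initial state is assumed. Multiplying its characteristic function by `exp
(⟪u, S u⟫ / 2)` gives a continuous function invariant under `u ↦ T* u`. The iterates of `T*` tend to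
zero, so the function is constantly its value `1` at the origin. -/
theorem charFun_init (hS : IsLyapunovSolution (Matrix.toEuclideanLin Θ) (Matrix.toEuclideanLin S) γ ν)
    (u : EuclideanSpace ℝ (Fin p)) :
    charFun (μ.map (Z 0)) u = Complex.exp (-(⟪u, Matrix.toEuclideanLin S u⟫ : ℝ) / 2) := by
  set T := Matrix.toEuclideanLin Θ
  set φ := charFun (μ.map (Z 0)) with hφ
  have : IsProbabilityMeasure (μ.map (Z 0)) :=
    Measure.isProbabilityMeasure_map h.measurable_init.aemeasurable
  have hnoise : ∀ u, charFun (μ.map (W 0)) u = Complex.exp (-(ν ^ 2 * ⟪u, u⟫ : ℝ) / 2) := fun u => by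
    rw [h.noise_law, charFun_multivariateGaussian (Matrix.PosSemidef.one.smul (sq_nonneg ν)),
      ← inner_toEuclideanLin, map_smul]
    simp [Matrix.toLpLin_one, real_inner_smul_right, neg_div]
  have hstep : ∀ u, φ u = φ (T.adjoint u) * Complex.exp (-(ν ^ 2 * ⟪u, u⟫ : ℝ) / 2) := fun u => by
    rw [hφ, ← (h.identDistrib 1).map_eq, ← hnoise, (h.identDistrib 1).map_eq,
      ← charFun_map_toEuclideanLin_add h.measurable_init (h.measurable_noise 0)
      (h.indepFun_init_noise 0) T u, ← (h.identDistrib 1).map_eq]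
    congr 2
    exact funext fun ω => h.recursion 0 ω
  set ψ : EuclideanSpace ℝ (Fin p) → ℂ := fun u =>
    φ u * Complex.exp ((⟪u, Matrix.toEuclideanLin S u⟫ : ℝ) / 2) with hψ
  have hψstep : ∀ u, ψ u = ψ (T.adjoint u) := fun u => by
    simp only [hψ]
    rw [hstep u, hS.inner_eq u u, mul_assoc, ← Complex.exp_add]
    congr 2
    push_cast
    ring
  have hψpow : ∀ k : ℕ, ψ u = ψ ((T.adjoint ^ k) u) := fun k => by
    induction k with
    | zero => simp
    | succ k ih => rw [ih, hψstep, pow_succ', Module.End.mul_apply]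
  have hcont : Continuous ψ := by
    have hS' : Continuous (Matrix.toEuclideanLin S) :=
      LinearMap.continuous_of_finiteDimensional _
    have hφc : Continuous φ := continuous_charFun
    exact hφc.mul (Complex.continuous_exp.comp
      ((Complex.continuous_ofReal.comp (continuous_id.inner hS')).div_const 2))
  have hlim := (hcont.tendsto 0).comp (hS.tendsto_adjoint_pow u)
  have hψ0 : ψ 0 = 1 := by simp [hψ, hφ]
  have hψu : ψ u = 1 := by
    refine tendsto_nhds_unique ?_ (hψ0 ▸ hlim)
    refine tendsto_const_nhds.congr fun k => ?_
    exact hψpow k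
  have h1 : φ u * Complex.exp ((⟪u, Matrix.toEuclideanLin S u⟫ : ℝ) / 2) = 1 := hψu
  rw [eq_comm, neg_div, Complex.exp_neg]
  exact (eq_inv_of_mul_eq_one_left h1).symm

end IsStationaryGaussianVAR

theorem IsLyapunovSolution.posSemidef {T : EuclideanSpace ℝ (Fin p) →ₗ[ℝ] EuclideanSpace ℝ (Fin p)}
    {S : Matrix (Fin p) (Fin p) ℝ} {γ ν : ℝ}
    (hS : IsLyapunovSolution T (Matrix.toEuclideanLin S) γ ν) : S.PosSemidef := by
  rw [← Matrix.isPositive_toEuclideanLin_iff]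
  refine ⟨hS.isSymmetric, fun x => ?_⟩
  rw [real_inner_comm]
  exact hS.inner_nonneg x

namespace IsStationaryGaussianVAR

variable {Θ S : Matrix (Fin p) (Fin p) ℝ} {ν γ : ℝ} {Z W : ℕ → Ω → EuclideanSpace ℝ (Fin p)}
  (h : IsStationaryGaussianVAR μ Θ ν Z W)
  (hS : IsLyapunovSolution (Matrix.toEuclideanLin Θ) (Matrix.toEuclideanLin S) γ ν)
include h

omit [IsProbabilityMeasure μ] in
theorem hasGaussianLaw_noise (t : ℕ) : HasGaussianLaw (W t) μ :=
  hasGaussianLaw_of_map_eq (h.noise_law t)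

omit [IsProbabilityMeasure μ] in
theorem integral_inner_noise (t : ℕ) (u : EuclideanSpace ℝ (Fin p)) :
    ∫ ω, ⟪u, W t ω⟫ ∂μ = 0 :=
  integral_inner_of_map_eq (h.measurable_noise t) (h.noise_law t) u

omit [IsProbabilityMeasure μ] in
theorem memLp_inner_noise (t : ℕ) (u : EuclideanSpace ℝ (Fin p)) :
    MemLp (fun ω => ⟪u, W t ω⟫) 2 μ :=
  (hasGaussianLaw_inner (h.hasGaussianLaw_noise t) u).memLp_two

theorem covariance_noise (t : ℕ) (u v : EuclideanSpace ℝ (Fin p)) :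
    cov[fun ω => ⟪u, W t ω⟫, fun ω => ⟪v, W t ω⟫; μ] = ν ^ 2 * ⟪u, v⟫ := by
  rw [covariance_inner_of_map_eq (h.measurable_noise t) (h.noise_law t)
    (Matrix.PosSemidef.one.smul (sq_nonneg ν)), map_smul]
  simp [Matrix.toLpLin_one, real_inner_smul_right]

omit [IsProbabilityMeasure μ] in
theorem covariance_noise_of_ne {s t : ℕ} (hst : s ≠ t) (u v : EuclideanSpace ℝ (Fin p)) :
    cov[fun ω => ⟪u, W s ω⟫, fun ω => ⟪v, W t ω⟫; μ] = 0 :=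
  ((h.noise_indep.indepFun hst).comp (φ := fun x => ⟪u, x⟫) (ψ := fun x => ⟪v, x⟫)
    (by fun_prop) (by fun_prop)).covariance_eq_zero (h.memLp_inner_noise s u)
    (h.memLp_inner_noise t v)

include hS

theorem map_eq_multivariateGaussian (t : ℕ) : μ.map (Z t) = multivariateGaussian 0 S := by
  rw [(h.identDistrib t).map_eq]
  have : IsProbabilityMeasure (μ.map (Z 0)) :=
    Measure.isProbabilityMeasure_map h.measurable_init.aemeasurable
  refine Measure.ext_of_charFun (funext fun u => ?_)
  rw [h.charFun_init hS, charFun_multivariateGaussian hS.posSemidef, ← inner_toEuclideanLin,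
    inner_zero_right]
  simp [neg_div]

theorem hasGaussianLaw (t : ℕ) : HasGaussianLaw (Z t) μ :=
  hasGaussianLaw_of_map_eq (h.map_eq_multivariateGaussian hS t)

theorem integral_inner (t : ℕ) (u : EuclideanSpace ℝ (Fin p)) : ∫ ω, ⟪u, Z t ω⟫ ∂μ = 0 :=
  integral_inner_of_map_eq (h.measurable t) (h.map_eq_multivariateGaussian hS t) u

theorem memLp_inner (t : ℕ) (u : EuclideanSpace ℝ (Fin p)) : MemLp (fun ω => ⟪u, Z t ω⟫) 2 μ :=
  (hasGaussianLaw_inner (h.hasGaussianLaw hS t) u).memLp_two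

theorem covariance_self (t : ℕ) (u v : EuclideanSpace ℝ (Fin p)) :
    cov[fun ω => ⟪u, Z t ω⟫, fun ω => ⟪v, Z t ω⟫; μ] = ⟪u, Matrix.toEuclideanLin S v⟫ :=
  covariance_inner_of_map_eq (h.measurable t) (h.map_eq_multivariateGaussian hS t) hS.posSemidef u v

omit [IsProbabilityMeasure μ] hS in
theorem inner_succ (t : ℕ) (u : EuclideanSpace ℝ (Fin p)) :
    (fun ω => ⟪u, Z (t + 1) ω⟫) =
      (fun ω => ⟪(Matrix.toEuclideanLin Θ).adjoint u, Z t ω⟫) + fun ω => ⟪u, W t ω⟫ := by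
  funext ω
  rw [h.recursion, inner_add_right, Pi.add_apply, LinearMap.adjoint_inner_left]

theorem covariance_state_noise {s t : ℕ} (hst : s ≤ t) (u v : EuclideanSpace ℝ (Fin p)) :
    cov[fun ω => ⟪u, Z s ω⟫, fun ω => ⟪v, W t ω⟫; μ] = 0 := by
  induction s generalizing u with
  | zero =>
    exact ((h.indepFun_init_noise t).comp (φ := fun x => ⟪u, x⟫) (ψ := fun x => ⟪v, x⟫)
      (by fun_prop) (by fun_prop)).covariance_eq_zero (h.memLp_inner hS 0 u)
      (h.memLp_inner_noise t v)
  | succ s ih =>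
    rw [h.inner_succ, covariance_add_left (h.memLp_inner hS s _) (h.memLp_inner_noise s u)
      (h.memLp_inner_noise t v), ih (by omega), h.covariance_noise_of_ne (by omega), add_zero]

theorem covariance_add (s k : ℕ) (u v : EuclideanSpace ℝ (Fin p)) :
    cov[fun ω => ⟪u, Z s ω⟫, fun ω => ⟪v, Z (s + k) ω⟫; μ] =
      ⟪u, Matrix.toEuclideanLin S (((Matrix.toEuclideanLin Θ).adjoint ^ k) v)⟫ := by
  induction k generalizing v with
  | zero => simpa using h.covariance_self hS s u v
  | succ k ih =>
    rw [← add_assoc, h.inner_succ, covariance_add_right (h.memLp_inner hS s u)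
      (h.memLp_inner hS _ _) (h.memLp_inner_noise _ v), ih,
      h.covariance_state_noise hS (by omega), add_zero, pow_succ, Module.End.mul_apply]

end IsStationaryGaussianVAR

end GaussianVAR

/-! ### Covariance bounds for the scalar processes in a fixed direction. -/

noncomputable section Autocovariance

open scoped RealInnerProductSpace NNReal ENNReal

theorem sum_pow_dist_le {γ : ℝ} (h0 : 0 ≤ γ) (h1 : γ < 1) {n s : ℕ} (hs : s < n) :
    ∑ t : Fin n, γ ^ (Nat.dist s t) ≤ (1 + γ) / (1 - γ) := by
  have hgeom : ∀ m : ℕ, ∑ k ∈ Finset.range m, γ ^ k ≤ (1 - γ)⁻¹ := fun m => by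
    rw [← tsum_geometric_of_lt_one h0 h1]
    exact (summable_geometric_of_lt_one h0 h1).sum_le_tsum _ fun _ _ => by positivity
  rw [Fin.sum_univ_eq_sum_range (fun t => γ ^ (Nat.dist s t)) n]
  obtain ⟨m, rfl⟩ := Nat.exists_eq_add_of_le hs.le
  rw [Finset.sum_range_add, ← Finset.sum_range_reflect]
  have e1 : ∑ j ∈ Finset.range s, γ ^ (Nat.dist s (s - 1 - j)) =
      γ * ∑ j ∈ Finset.range s, γ ^ j := by
    rw [Finset.mul_sum]
    refine Finset.sum_congr rfl fun j hj => ?_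
    rw [← pow_succ']
    congr 1
    have := Finset.mem_range.1 hj
    simp only [Nat.dist]
    omega
  have e2 : ∑ j ∈ Finset.range m, γ ^ (Nat.dist s (s + j)) = ∑ j ∈ Finset.range m, γ ^ j := by
    refine Finset.sum_congr rfl fun j _ => ?_
    congr 1
    simp only [Nat.dist]
    omega
  rw [e1, e2]
  have e3 : (1 + γ) / (1 - γ) = γ * (1 - γ)⁻¹ + (1 - γ)⁻¹ := by
    field_simp
    ring
  rw [e3]
  exact add_le_add (mul_le_mul_of_nonneg_left (hgeom _) h0) (hgeom _)

variable {Ω : Type*} [MeasurableSpace Ω] {μ : Measure Ω} [IsProbabilityMeasure μ] {p : ℕ}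

theorem variance_fun_add_le {X Y : Ω → ℝ} (hX : MemLp X 2 μ) (hY : MemLp Y 2 μ) :
    Var[fun ω => X ω + Y ω; μ] ≤ 2 * Var[X; μ] + 2 * Var[Y; μ] := by
  have h1 := variance_add hX hY
  have h2 := variance_sub hX hY
  have h3 := variance_nonneg (X - Y) μ
  have h4 : Var[fun ω => X ω + Y ω; μ] = Var[X + Y; μ] := rfl
  linarith

namespace IsStationaryGaussianVAR

variable {Θ S : Matrix (Fin p) (Fin p) ℝ} {ν γ : ℝ} {Z W : ℕ → Ω → EuclideanSpace ℝ (Fin p)}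
  (h : IsStationaryGaussianVAR μ Θ ν Z W)
  (hS : IsLyapunovSolution (Matrix.toEuclideanLin Θ) (Matrix.toEuclideanLin S) γ ν)
include h

omit [IsProbabilityMeasure μ] in
-- Provides joint Gaussianity: all states up to time `n` are linear images of one vector, the
-- initial state together with the first `n` innovations.
theorem exists_clm (n : ℕ) {t : ℕ} (ht : t ≤ n) :
    ∃ A : EuclideanSpace ℝ (Fin p) × (Fin n → EuclideanSpace ℝ (Fin p)) →L[ℝ]
      EuclideanSpace ℝ (Fin p), ∀ ω, Z t ω = A (Z 0 ω, fun i : Fin n => W i ω) := by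
  induction t with
  | zero => exact ⟨ContinuousLinearMap.fst ℝ _ _, fun ω => rfl⟩
  | succ t ih =>
    obtain ⟨A, hA⟩ := ih (by omega)
    refine ⟨(LinearMap.toContinuousLinearMap (Matrix.toEuclideanLin Θ)).comp A +
      (ContinuousLinearMap.proj (R := ℝ) (φ := fun _ : Fin n => EuclideanSpace ℝ (Fin p))
        ⟨t, by omega⟩).comp (ContinuousLinearMap.snd ℝ _ _), fun ω => ?_⟩
    rw [h.recursion, hA]
    simp

include hS

theorem hasGaussianLaw_init_noise (n : ℕ) :
    HasGaussianLaw (fun ω => (Z 0 ω, fun i : Fin n => W i ω)) μ := by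
  refine IndepFun.hasGaussianLaw (h.hasGaussianLaw hS 0) ?_ ?_
  · exact iIndepFun.hasGaussianLaw (X := fun i : Fin n => W i)
      (fun i => h.hasGaussianLaw_noise i) (h.noise_indep.precomp Fin.val_injective)
  · exact h.init_indep.comp (ψ := fun w (i : Fin n) => w i) measurable_id
      (measurable_pi_lambda _ fun i => measurable_pi_apply _)

theorem hasGaussianLaw_combination (n : ℕ) (u v : EuclideanSpace ℝ (Fin p)) :
    HasGaussianLaw (fun ω (t : Fin n) => ⟪u, W t ω⟫ + ⟪v, Z t ω⟫) μ := by
  choose A hA using fun t : Fin n => h.exists_clm n t.2.le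
  have := (h.hasGaussianLaw_init_noise hS n).map_fun (ContinuousLinearMap.pi fun t : Fin n =>
    (innerSL ℝ u).comp ((ContinuousLinearMap.proj (R := ℝ)
      (φ := fun _ : Fin n => EuclideanSpace ℝ (Fin p)) t).comp (ContinuousLinearMap.snd ℝ _ _)) +
    (innerSL ℝ v).comp (A t))
  have e : (fun ω (t : Fin n) => ⟪u, W t ω⟫ + ⟪v, Z t ω⟫) = fun ω =>
      (ContinuousLinearMap.pi fun t : Fin n =>
        (innerSL ℝ u).comp ((ContinuousLinearMap.proj (R := ℝ)
          (φ := fun _ : Fin n => EuclideanSpace ℝ (Fin p)) t).comp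
            (ContinuousLinearMap.snd ℝ _ _)) +
        (innerSL ℝ v).comp (A t)) (Z 0 ω, fun i : Fin n => W i ω) := by
    funext ω t
    simp [hA t ω]
  rw [e]
  exact this

theorem integral_combination (t : ℕ) (u v : EuclideanSpace ℝ (Fin p)) :
    ∫ ω, ⟪u, W t ω⟫ + ⟪v, Z t ω⟫ ∂μ = 0 := by
  rw [integral_add ((h.memLp_inner_noise t u).integrable one_le_two)
    ((h.memLp_inner hS t v).integrable one_le_two), h.integral_inner_noise,
    h.integral_inner hS, add_zero]

theorem variance_combination (t : ℕ) (u v : EuclideanSpace ℝ (Fin p)) :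
    Var[fun ω => ⟪u, W t ω⟫ + ⟪v, Z t ω⟫; μ] =
      ν ^ 2 * ‖u‖ ^ 2 + ⟪v, Matrix.toEuclideanLin S v⟫ := by
  have h1 := variance_add (h.memLp_inner_noise t u) (h.memLp_inner hS t v)
  rw [covariance_comm, h.covariance_state_noise hS le_rfl, ← ProbabilityTheory.covariance_self
    (h.memLp_inner_noise t u).aemeasurable, ← ProbabilityTheory.covariance_self
    (h.memLp_inner hS t v).aemeasurable, h.covariance_noise, h.covariance_self hS,
    real_inner_self_eq_norm_sq, mul_zero, add_zero] at h1
  exact h1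

theorem abs_covariance_le (s t : ℕ) (v : EuclideanSpace ℝ (Fin p)) :
    |cov[fun ω => ⟪v, Z s ω⟫, fun ω => ⟪v, Z t ω⟫; μ]| ≤
      sigmaMax S * ‖v‖ ^ 2 * γ ^ Nat.dist s t := by
  wlog hst : s ≤ t generalizing s t
  · rw [covariance_comm, Nat.dist_comm]
    exact this t s (by omega)
  obtain ⟨k, rfl⟩ := Nat.exists_eq_add_of_le hst
  rw [h.covariance_add hS]
  have hk : Nat.dist s (s + k) = k := by simp [Nat.dist]
  rw [hk]
  refine (abs_real_inner_le_norm _ _).trans ?_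
  calc ‖v‖ * ‖Matrix.toEuclideanLin S (((Matrix.toEuclideanLin Θ).adjoint ^ k) v)‖
      ≤ ‖v‖ * (sigmaMax S * (γ ^ k * ‖v‖)) := by
        refine mul_le_mul_of_nonneg_left ?_ (norm_nonneg _)
        refine (norm_apply_le_singularValues_zero finrank_euclideanSpace_fin _ _).trans ?_
        exact mul_le_mul_of_nonneg_left (hS.norm_adjoint_pow_le k v)
          (LinearMap.singularValues_nonneg _ _)
    _ = sigmaMax S * ‖v‖ ^ 2 * γ ^ k := by ring

/-- Schur's test: by `2|ab| ≤ a² + b²` the quadratic form is bounded by the largest absolute row sum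
of the covariance matrix, a two-sided geometric series in `γ`. -/
theorem variance_sum_state_le (n : ℕ) (v : EuclideanSpace ℝ (Fin p)) (a : Fin n → ℝ) :
    Var[fun ω => ∑ t, a t * ⟪v, Z t ω⟫; μ] ≤
      sigmaMax S * ‖v‖ ^ 2 * ((1 + γ) / (1 - γ)) * ∑ t, a t ^ 2 := by
  have hL2 : ∀ t : Fin n, MemLp (fun ω => a t * ⟪v, Z t ω⟫) 2 μ := fun t =>
    (h.memLp_inner hS t v).const_mul _
  set c := sigmaMax S * ‖v‖ ^ 2
  have hc0 : 0 ≤ c := mul_nonneg (LinearMap.singularValues_nonneg _ _) (sq_nonneg _)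
  have hγ := hS.nonneg
  rw [← ProbabilityTheory.covariance_self (memLp_finsetSum _ fun t _ => hL2 t).aemeasurable,
    covariance_fun_sum_fun_sum hL2 hL2]
  simp_rw [covariance_const_mul_left, covariance_const_mul_right]
  have hterm : ∀ s t : Fin n, a s * (a t * cov[fun ω => ⟪v, Z s ω⟫, fun ω => ⟪v, Z t ω⟫; μ]) ≤
      c / 2 * (a s ^ 2 * γ ^ Nat.dist s t) + c / 2 * (a t ^ 2 * γ ^ Nat.dist t s) := fun s t => by
    have h1 := h.abs_covariance_le hS s t v
    rw [Nat.dist_comm t s]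
    calc a s * (a t * cov[fun ω => ⟪v, Z s ω⟫, fun ω => ⟪v, Z t ω⟫; μ])
        ≤ |a s * a t| * |cov[fun ω => ⟪v, Z s ω⟫, fun ω => ⟪v, Z t ω⟫; μ]| := by
          rw [← mul_assoc, ← abs_mul]
          exact le_abs_self _
      _ ≤ (a s ^ 2 + a t ^ 2) / 2 * (c * γ ^ Nat.dist s t) := by
          gcongr
          rw [abs_mul]
          nlinarith [sq_nonneg (|a s| - |a t|), sq_abs (a s), sq_abs (a t)]
      _ = _ := by ring
  refine (Finset.sum_le_sum fun s _ => Finset.sum_le_sum fun t _ => hterm s t).trans ?_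
  have hrow : ∑ s, ∑ t : Fin n, c / 2 * (a s ^ 2 * γ ^ Nat.dist s t) ≤
      c / 2 * ((1 + γ) / (1 - γ)) * ∑ s, a s ^ 2 := by
    rw [Finset.mul_sum]
    refine Finset.sum_le_sum fun s _ => ?_
    rw [← Finset.mul_sum, ← Finset.mul_sum]
    calc c / 2 * (a s ^ 2 * ∑ t : Fin n, γ ^ Nat.dist s t)
        ≤ c / 2 * (a s ^ 2 * ((1 + γ) / (1 - γ))) := by
          gcongr
          exact sum_pow_dist_le hγ hS.lt_one s.2
      _ = _ := by ring
  simp_rw [Finset.sum_add_distrib]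
  rw [Finset.sum_comm (f := fun s t : Fin n => c / 2 * (a t ^ 2 * γ ^ Nat.dist t s))]
  linarith

omit hS in
theorem variance_sum_noise (n : ℕ) (u : EuclideanSpace ℝ (Fin p)) (a : Fin n → ℝ) :
    Var[fun ω => ∑ t : Fin n, a t * ⟪u, W t ω⟫; μ] = ν ^ 2 * ‖u‖ ^ 2 * ∑ t, a t ^ 2 := by
  have hL2 : ∀ t : Fin n, MemLp (fun ω => a t * ⟪u, W t ω⟫) 2 μ := fun t =>
    (h.memLp_inner_noise t u).const_mul _
  rw [← ProbabilityTheory.covariance_self (memLp_finsetSum _ fun t _ => hL2 t).aemeasurable,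
    covariance_fun_sum_fun_sum hL2 hL2, Finset.mul_sum]
  simp_rw [covariance_const_mul_left, covariance_const_mul_right]
  refine Finset.sum_congr rfl fun s _ => ?_
  rw [Finset.sum_eq_single s]
  · rw [h.covariance_noise, real_inner_self_eq_norm_sq]
    ring
  · intro t _ hts
    rw [h.covariance_noise_of_ne (fun e => hts (Fin.ext e.symm)), mul_zero, mul_zero]
  · simp

theorem isGaussianWithCovLE_combination (n : ℕ) (u v : EuclideanSpace ℝ (Fin p)) :
    IsGaussianWithCovLE (fun (t : Fin n) ω => ⟪u, W t ω⟫ + ⟪v, Z t ω⟫) μ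
      (2 * (ν ^ 2 * ‖u‖ ^ 2) + 2 * (sigmaMax S * ‖v‖ ^ 2 * ((1 + γ) / (1 - γ)))) where
  gaussian := h.hasGaussianLaw_combination hS n u v
  centred t := h.integral_combination hS t u v
  variance_le a := by
    have e : (fun ω => ∑ t : Fin n, a t * (⟪u, W t ω⟫ + ⟪v, Z t ω⟫)) = fun ω =>
        ∑ t : Fin n, a t * ⟪u, W t ω⟫ + ∑ t : Fin n, a t * ⟪v, Z t ω⟫ := by
      funext ω
      rw [← Finset.sum_add_distrib]
      exact Finset.sum_congr rfl fun t _ => mul_add _ _ _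
    rw [e]
    have hW : MemLp (fun ω => ∑ t : Fin n, a t * ⟪u, W t ω⟫) 2 μ :=
      memLp_finsetSum (f := fun (t : Fin n) ω => a t * ⟪u, W t ω⟫) _ fun t _ =>
        (h.memLp_inner_noise t u).const_mul (a t)
    have hZ : MemLp (fun ω => ∑ t : Fin n, a t * ⟪v, Z t ω⟫) 2 μ :=
      memLp_finsetSum (f := fun (t : Fin n) ω => a t * ⟪v, Z t ω⟫) _ fun t _ =>
        (h.memLp_inner hS t v).const_mul (a t)
    refine (variance_fun_add_le hW hZ).trans ?_
    rw [h.variance_sum_noise]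
    have := h.variance_sum_state_le hS n v a
    linarith

theorem isGaussianWithCovLE_state (n : ℕ) (v : EuclideanSpace ℝ (Fin p)) :
    IsGaussianWithCovLE (fun (t : Fin n) ω => ⟪v, Z t ω⟫) μ
      (sigmaMax S * ‖v‖ ^ 2 * ((1 + γ) / (1 - γ))) where
  gaussian := by simpa using h.hasGaussianLaw_combination hS n 0 v
  centred t := h.integral_inner hS t v
  variance_le a := h.variance_sum_state_le hS n v a

theorem variance_state (t : ℕ) (v : EuclideanSpace ℝ (Fin p)) :
    Var[fun ω => ⟪v, Z t ω⟫; μ] = ⟪v, Matrix.toEuclideanLin S v⟫ := by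
  rw [← ProbabilityTheory.covariance_self (h.memLp_inner hS t v).aemeasurable,
    h.covariance_self hS]

end IsStationaryGaussianVAR

end Autocovariance

/-! ### The noise, second-moment and curvature events. -/

noncomputable section DeviationEvents

open scoped RealInnerProductSpace NNReal ENNReal
open Real (exp)

section CrossMoment

variable {E : Type*} [NormedAddCommGroup E] [InnerProductSpace ℝ E]

/-- The empirical cross moment `∑ t < n, wₜ zₜᵀ` (not divided by `n`). -/
def crossMoment (n : ℕ) (w z : ℕ → E) : E →ₗ[ℝ] E :=
  ∑ t ∈ Finset.range n, (innerₗ E (z t)).smulRight (w t)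

theorem crossMoment_apply (n : ℕ) (w z : ℕ → E) (x : E) :
    crossMoment n w z x = ∑ t ∈ Finset.range n, ⟪z t, x⟫ • w t := by
  simp [crossMoment, LinearMap.sum_apply]

theorem inner_crossMoment (n : ℕ) (w z : ℕ → E) (x y : E) :
    ⟪x, crossMoment n w z y⟫ = ∑ t ∈ Finset.range n, ⟪x, w t⟫ * ⟪y, z t⟫ := by
  rw [crossMoment_apply, inner_sum]
  refine Finset.sum_congr rfl fun t _ => ?_
  rw [real_inner_smul_right, real_inner_comm, mul_comm]

theorem inner_crossMoment_self (n : ℕ) (z : ℕ → E) (x : E) :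
    ⟪x, crossMoment n z z x⟫ = ∑ t ∈ Finset.range n, ⟪x, z t⟫ ^ 2 := by
  simp_rw [inner_crossMoment, sq]

theorem isSymmetric_crossMoment (n : ℕ) (z : ℕ → E) : (crossMoment n z z).IsSymmetric := by
  intro x y
  rw [real_inner_comm, inner_crossMoment, inner_crossMoment]
  exact Finset.sum_congr rfl fun t _ => mul_comm _ _

end CrossMoment

/-- The net has at most `9^p` points and `9 ≤ e^{5/2}`, so a tail `e^{-3p}` per point survives the
union bound. -/
theorem nine_pow_mul_exp_le (p : ℕ) : (9 : ℝ) ^ p * exp (-(3 * p)) ≤ exp (-(1 / 2) * p) := by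
  have h1 : (9 : ℝ) ≤ exp (5 / 2) := by
    have h2 : (81 : ℝ) ≤ exp 5 := by
      have h3 : exp 5 = exp 1 ^ 5 := by rw [← Real.exp_nat_mul]; norm_num
      have h4 : (2.7 : ℝ) ≤ exp 1 := by linarith [Real.exp_one_gt_d9]
      rw [h3]
      calc (81 : ℝ) ≤ 2.7 ^ 5 := by norm_num
        _ ≤ exp 1 ^ 5 := by gcongr
    have h5 : exp (5 / 2) ^ 2 = exp 5 := by rw [← Real.exp_nat_mul]; norm_num
    nlinarith [Real.exp_pos (5 / 2)]
  calc (9 : ℝ) ^ p * exp (-(3 * p)) ≤ exp (5 / 2) ^ p * exp (-(3 * p)) := by gcongr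
    _ = exp (-(1 / 2) * p) := by
      rw [← Real.exp_nat_mul, ← Real.exp_add]
      congr 1
      ring

theorem measureReal_exists_mem_le {Ω α : Type*} [MeasurableSpace Ω] {μ : Measure Ω} {s : Finset α}
    {P : α → Ω → Prop} {N c : ℝ} (hN : (s.card : ℝ) ≤ N) (hc : 0 ≤ c)
    (h : ∀ a ∈ s, μ.real {ω | P a ω} ≤ c) : μ.real {ω | ∃ a ∈ s, P a ω} ≤ N * c := by
  have h1 : {ω | ∃ a ∈ s, P a ω} = ⋃ a ∈ s, {ω | P a ω} := by
    ext ω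
    simp
  rw [h1]
  calc μ.real (⋃ a ∈ s, {ω | P a ω}) ≤ ∑ a ∈ s, μ.real {ω | P a ω} :=
        measureReal_biUnion_finset_le _ _
    _ ≤ ∑ a ∈ s, c := Finset.sum_le_sum h
    _ = s.card * c := by rw [Finset.sum_const, nsmul_eq_mul]
    _ ≤ N * c := by gcongr

section Whitening

variable {E : Type*} [NormedAddCommGroup E] [InnerProductSpace ℝ E] [FiniteDimensional ℝ E]

/-- A positive definite operator is congruent to the identity. -/
theorem exists_whitening (A : E →ₗ[ℝ] E) (hA : A.IsSymmetric) (hpos : ∀ x ≠ 0, 0 < ⟪x, A x⟫) :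
    ∃ C : E →ₗ[ℝ] E, Function.Surjective C ∧ ∀ x, ⟪C x, A (C x)⟫ = ‖x‖ ^ 2 := by
  set e := hA.eigenvectorBasis rfl
  set m := hA.eigenvalues rfl
  have he : ∀ i, A (e i) = m i • e i := hA.apply_eigenvectorBasis rfl
  have hm : ∀ i, 0 < m i := fun i => by
    have := hpos (e i) (e.orthonormal.ne_zero i)
    rwa [he, real_inner_smul_right, real_inner_self_eq_norm_sq, e.norm_eq_one, one_pow,
      mul_one] at this
  set C : E →ₗ[ℝ] E := ∑ i, (√(m i))⁻¹ • (innerₗ E (e i)).smulRight (e i)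
  have hCx : ∀ x, C x = ∑ i, ((√(m i))⁻¹ * ⟪e i, x⟫) • e i := fun x => by
    simp [C, LinearMap.sum_apply, smul_smul]
  have hCi : ∀ x i, ⟪e i, C x⟫ = (√(m i))⁻¹ * ⟪e i, x⟫ := fun x i => by
    rw [hCx]
    exact e.orthonormal.inner_right_fintype _ i
  refine ⟨C, fun y => ⟨∑ i, (√(m i) * ⟪e i, y⟫) • e i, ?_⟩, fun x => ?_⟩
  · rw [hCx, ← e.sum_repr' y]
    refine Finset.sum_congr rfl fun i _ => ?_
    rw [e.sum_repr' y, e.orthonormal.inner_right_fintype, ← mul_assoc,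
      inv_mul_cancel₀ (Real.sqrt_pos.2 (hm i)).ne', one_mul]
  · rw [← e.sum_inner_mul_inner, ← e.sum_sq_norm_inner_right x]
    refine Finset.sum_congr rfl fun i _ => ?_
    rw [← hA, he, real_inner_smul_left, real_inner_comm, hCi, Real.norm_eq_abs, sq_abs]
    have h1 := Real.sq_sqrt (hm i).le
    have h2 := (Real.sqrt_pos.2 (hm i)).ne'
    field_simp
    rw [h1, mul_comm]

end Whitening

/-- The relative sampling error `√(p / n) / (1 - γ)`. -/
def samplingError (p n : ℕ) (γ : ℝ) : ℝ := √((p : ℝ) / n) / (1 - γ)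

theorem samplingError_pos {p n : ℕ} {γ : ℝ} (hp : 0 < p) (hn : 0 < n) (hγ : γ < 1) :
    0 < samplingError p n γ :=
  div_pos (Real.sqrt_pos.2 (by positivity)) (by linarith)

/-- The right side is `√(np)`; the constant `100` in the sample size is needed for this bound, which
serves the exponential regime of the tails. -/
theorem ten_mul_le_mul_samplingError {p n : ℕ} {γ : ℝ} (hn : 100 * (p : ℝ) < n) (hγ : γ < 1) :
    10 * (p : ℝ) ≤ n * (1 - γ) * samplingError p n γ := by
  have hn0 : (0 : ℝ) < n := lt_of_le_of_lt (by positivity) hn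
  have h1 : n * (1 - γ) * samplingError p n γ = n * √((p : ℝ) / n) := by
    rw [samplingError]
    have : (1 - γ) ≠ 0 := by linarith
    field_simp
  rw [h1]
  set r := √((p : ℝ) / n) with hr
  have hr0 : 0 ≤ r := Real.sqrt_nonneg _
  have hr2 : r ^ 2 = p / n := Real.sq_sqrt (by positivity)
  have hr3 : n * r ^ 2 = p := by rw [hr2]; field_simp
  have hr4 : r ≤ 1 / 10 := by
    rw [hr, Real.sqrt_le_left (by norm_num), div_le_iff₀ hn0]
    linarith
  rw [← hr3]
  nlinarith [mul_nonneg hn0.le hr0]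

theorem mul_sq_samplingError {p n : ℕ} {γ : ℝ} (hn : 0 < n) (hγ : γ < 1) :
    n * (1 - γ) ^ 2 * samplingError p n γ ^ 2 = p := by
  have hn0 : (0 : ℝ) < n := Nat.cast_pos.2 hn
  have : (1 - γ) ≠ 0 := by linarith
  rw [samplingError, div_pow, Real.sq_sqrt (by positivity)]
  field_simp

theorem le_mul_sq_samplingError {p n : ℕ} {γ : ℝ} (hn : 0 < n) (hγ : γ < 1) (hγ0 : 0 ≤ γ) :
    (p : ℝ) ≤ n * (1 - γ) * samplingError p n γ ^ 2 := by
  have h1 := mul_sq_samplingError (p := p) hn hγ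
  have h2 : 0 ≤ n * (1 - γ) * samplingError p n γ ^ 2 :=
    mul_nonneg (mul_nonneg (Nat.cast_nonneg _) (by linarith)) (sq_nonneg _)
  nlinarith

theorem inner_toEuclideanLin_le_sigmaMax {p : ℕ} (S : Matrix (Fin p) (Fin p) ℝ)
    {v : EuclideanSpace ℝ (Fin p)} (hv : ‖v‖ = 1) :
    ⟪v, Matrix.toEuclideanLin S v⟫ ≤ sigmaMax S := by
  refine (real_inner_le_norm _ _).trans ?_
  rw [hv, one_mul]
  refine (norm_apply_le_singularValues_zero finrank_euclideanSpace_fin _ _).trans_eq ?_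
  rw [hv, mul_one]
  rfl

namespace IsStationaryGaussianVAR

variable {Ω : Type*} [MeasurableSpace Ω] {μ : Measure Ω} [IsProbabilityMeasure μ] {p n : ℕ}
  {Θ S : Matrix (Fin p) (Fin p) ℝ} {ν γ : ℝ} {Z W : ℕ → Ω → EuclideanSpace ℝ (Fin p)}
  (h : IsStationaryGaussianVAR μ Θ ν Z W)
  (hS : IsLyapunovSolution (Matrix.toEuclideanLin Θ) (Matrix.toEuclideanLin S) γ ν)
  (hp : 0 < p) (hn : 100 * (p : ℝ) < n) (hM : 0 < sigmaMax S)
include h hS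

theorem sum_variance_state (n : ℕ) (v : EuclideanSpace ℝ (Fin p)) :
    ∑ t : Fin n, Var[fun ω => ⟪v, Z t ω⟫; μ] = n * ⟪v, Matrix.toEuclideanLin S v⟫ := by
  simp_rw [h.variance_state hS]
  simp

include hp hn hM

/-- Polarization: four times the product is the difference of the squares of sum and difference, so
one upper tail and one lower tail suffice. -/
theorem measureReal_cross_le {u v : EuclideanSpace ℝ (Fin p)} (hu : ‖u‖ = 1) (hv : ‖v‖ = 1) :
    μ.real {ω | 25 / 2 * samplingError p n γ * n * sigmaMax S ≤
      ∑ t ∈ Finset.range n, ⟪u, W t ω⟫ * ⟪v, Z t ω⟫} ≤ 2 * exp (-(3 * p)) ^ 2 := by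
  set s := samplingError p n γ
  set M := sigmaMax S
  have hγ0 := hS.nonneg
  have hγ1 := hS.lt_one
  have hγ : 0 < 1 - γ := by linarith
  have hn0 : (0 : ℝ) < n := lt_of_le_of_lt (by positivity) hn
  have hn0' : 0 < n := Nat.cast_pos.1 hn0
  have hs : 0 < s := samplingError_pos hp hn0' hγ1
  have hs1 : 10 * (p : ℝ) ≤ n * (1 - γ) * s := ten_mul_le_mul_samplingError hn hγ1
  have hs2 : (p : ℝ) ≤ n * (1 - γ) * s ^ 2 := le_mul_sq_samplingError hn0' hγ1 hγ0
  have hvS := inner_toEuclideanLin_le_sigmaMax S hv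
  have hνM : ν ^ 2 ≤ M := by
    have := hS.sq_mul_norm_sq_le_inner v
    rw [hv] at this
    linarith
  have hcov : ∀ v' : EuclideanSpace ℝ (Fin p), ‖v'‖ = 1 →
      IsGaussianWithCovLE (fun (t : Fin n) ω => ⟪u, W t ω⟫ + ⟪v', Z t ω⟫) μ (4 * M / (1 - γ)) :=
    fun v' hv' => (h.isGaussianWithCovLE_combination hS n u v').mono (by
      rw [hu, hv']
      have : 4 * M / (1 - γ) = 2 * M + 2 * (M * ((1 + γ) / (1 - γ))) := by
        field_simp
        ring
      rw [this]
      linarith)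
  have hvar : ∀ v' : EuclideanSpace ℝ (Fin p),
      ∑ t : Fin n, Var[fun ω => ⟪u, W t ω⟫ + ⟪v', Z t ω⟫; μ] =
        n * (ν ^ 2 + ⟪v', Matrix.toEuclideanLin S v'⟫) := fun v' => by
    simp_rw [h.variance_combination hS, hu]
    simp [mul_add]
  have hV : n * (ν ^ 2 + ⟪v, Matrix.toEuclideanLin S v⟫) ≤ 2 * n * M := by nlinarith
  have hτ : 0 ≤ 25 * s * n * M := by positivity
  have hL : 0 < 4 * M / (1 - γ) := by positivity
  have hr1 : 6 * (p : ℝ) ≤ (25 * s * n * M) ^ 2 / (8 * (4 * M / (1 - γ)) * (2 * n * M)) := by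
    have : (25 * s * n * M) ^ 2 / (8 * (4 * M / (1 - γ)) * (2 * n * M)) =
        625 / 64 * (n * (1 - γ) * s ^ 2) := by
      field_simp
      ring
    rw [this]
    linarith
  have hr2 : 6 * (p : ℝ) ≤ 25 * s * n * M / (8 * (4 * M / (1 - γ))) := by
    have : 25 * s * n * M / (8 * (4 * M / (1 - γ))) = 25 / 32 * (n * (1 - γ) * s) := by
      field_simp
      ring
    rw [this]
    linarith
  have hplus := ((hcov v hv).measure_sum_sq_tails (τ := 25 * s * n * M) hL
    (by positivity : 0 < 2 * n * M) (by rw [hvar]; exact hV) hτ hr1 hr2).1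
  have hminus := ((hcov (-v) (by rwa [norm_neg])).measure_sum_sq_tails (τ := 25 * s * n * M) hL
    (by positivity : 0 < 2 * n * M) (by rw [hvar]; simpa using hV) hτ hr1 hr2).2
  -- State and concurrent innovation are uncorrelated, so both sums of squares have the same mean,
  -- which cancels in the difference.
  have hvar' := hvar (-v)
  rw [map_neg, inner_neg_neg, ← hvar v] at hvar'
  rw [hvar'] at hminus
  have hexp : exp (-(3 * p)) ^ 2 = exp (-(6 * p)) := by
    rw [← Real.exp_nat_mul]
    congr 1
    push_cast
    ring
  rw [hexp, two_mul]
  refine (measureReal_mono ?_).trans ((measureReal_union_le _ _).trans (add_le_add hplus hminus))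
  intro ω hω
  by_contra hcon
  simp only [Set.mem_union, Set.mem_ofPred_eq, not_or, not_le, inner_neg_left] at hcon hω
  have hid : ∑ t : Fin n, (⟪u, W t ω⟫ + ⟪v, Z t ω⟫) ^ 2 -
      ∑ t : Fin n, (⟪u, W t ω⟫ + -⟪v, Z t ω⟫) ^ 2 =
        4 * ∑ t ∈ Finset.range n, ⟪u, W t ω⟫ * ⟪v, Z t ω⟫ := by
    rw [Finset.sum_range, ← Finset.sum_sub_distrib, Finset.mul_sum]
    exact Finset.sum_congr rfl fun t _ => by ring
  linarith [hcon.1, hcon.2]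

theorem measureReal_noise_le :
    μ.real {ω | ¬ ∀ x, ‖crossMoment n (fun t => W t ω) (fun t => Z t ω) x‖ ≤
      25 * samplingError p n γ * n * sigmaMax S * ‖x‖} ≤ 2 * exp (-(1 / 2) * p) := by
  obtain ⟨N, hcard, hnorm, hnet⟩ := exists_quarter_net (EuclideanSpace ℝ (Fin p))
  rw [finrank_euclideanSpace_fin] at hcard
  have hcard' : (N.card : ℝ) ≤ 9 ^ p := by exact_mod_cast hcard
  set a := 25 / 2 * samplingError p n γ * n * sigmaMax S with ha
  have hn0 : (0 : ℝ) < n := lt_of_le_of_lt (by positivity) hn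
  have hs := samplingError_pos hp (Nat.cast_pos.1 hn0) hS.lt_one
  have ha0 : 0 ≤ a := by positivity
  have hsub : {ω | ¬ ∀ x, ‖crossMoment n (fun t => W t ω) (fun t => Z t ω) x‖ ≤
      25 * samplingError p n γ * n * sigmaMax S * ‖x‖} ⊆
      {ω | ∃ q ∈ N ×ˢ N, a ≤ ∑ t ∈ Finset.range n, ⟪q.1, W t ω⟫ * ⟪q.2, Z t ω⟫} := by
    intro ω hω
    by_contra hcon
    simp only [Set.mem_ofPred_eq, not_exists, not_and, not_le, Finset.mem_product] at hcon
    refine hω fun x => ?_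
    have := norm_apply_le_of_net hnet hnorm (by rwa [finrank_euclideanSpace_fin])
      (crossMoment n (fun t => W t ω) (fun t => Z t ω)) ha0 (fun u hu v hv => by
        rw [inner_crossMoment]
        exact (hcon (u, v) ⟨hu, hv⟩).le) x
    refine this.trans_eq ?_
    rw [ha]
    ring
  refine (measureReal_mono hsub).trans ?_
  -- The union runs over pairs of net points, which is why the single-pair tail was taken as
  -- `e^{-6p}`.
  refine (measureReal_exists_mem_le (N := 9 ^ p * 9 ^ p) (c := 2 * exp (-(3 * p)) ^ 2) ?_
    (by positivity) fun q hq => ?_).trans ?_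
  · rw [Finset.card_product]
    push_cast
    gcongr
  · rw [Finset.mem_product] at hq
    exact h.measureReal_cross_le hS hp hn hM (hnorm _ hq.1) (hnorm _ hq.2)
  · have h1 := nine_pow_mul_exp_le p
    have h2 : exp (-(1 / 2) * p) ≤ 1 := Real.exp_le_one_iff.2 (by
      have : (0 : ℝ) ≤ p := Nat.cast_nonneg _
      linarith)
    have h3 : 0 ≤ (9 : ℝ) ^ p * exp (-(3 * p)) := by positivity
    have h4 := (Real.exp_pos (-(1 / 2) * p)).le
    calc (9 : ℝ) ^ p * 9 ^ p * (2 * exp (-(3 * p)) ^ 2)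
        = 2 * (9 ^ p * exp (-(3 * p))) * (9 ^ p * exp (-(3 * p))) := by ring
      _ ≤ 2 * exp (-(1 / 2) * p) * 1 := by
          gcongr
          exact h1.trans h2
      _ = _ := by ring

theorem measureReal_second_moment_le (hs20 : 1 / 20 < samplingError p n γ) :
    μ.real {ω | ¬ ∀ x, ‖crossMoment n (fun t => Z t ω) (fun t => Z t ω) x‖ ≤
      54 * samplingError p n γ * n * sigmaMax S * ‖x‖} ≤ exp (-(1 / 2) * p) := by
  obtain ⟨N, hcard, hnorm, hnet⟩ := exists_quarter_net (EuclideanSpace ℝ (Fin p))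
  rw [finrank_euclideanSpace_fin] at hcard
  have hcard' : (N.card : ℝ) ≤ 9 ^ p := by exact_mod_cast hcard
  set s := samplingError p n γ
  set M := sigmaMax S
  have hγ0 := hS.nonneg
  have hγ1 := hS.lt_one
  have hγ : 0 < 1 - γ := by linarith
  have hn0 : (0 : ℝ) < n := lt_of_le_of_lt (by positivity) hn
  have hn0' : 0 < n := Nat.cast_pos.1 hn0
  have hs : 0 < s := samplingError_pos hp hn0' hγ1
  have hs1 : 10 * (p : ℝ) ≤ n * (1 - γ) * s := ten_mul_le_mul_samplingError hn hγ1
  have hs2 : (p : ℝ) ≤ n * (1 - γ) * s ^ 2 := le_mul_sq_samplingError hn0' hγ1 hγ0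
  have hsub : {ω | ¬ ∀ x, ‖crossMoment n (fun t => Z t ω) (fun t => Z t ω) x‖ ≤
      54 * s * n * M * ‖x‖} ⊆
      {ω | ∃ v ∈ N, 27 * s * n * M ≤ ∑ t ∈ Finset.range n, ⟪v, Z t ω⟫ ^ 2} := by
    intro ω hω
    by_contra hcon
    simp only [Set.mem_ofPred_eq, not_exists, not_and, not_le] at hcon
    refine hω fun x => ?_
    have := norm_apply_le_of_net_of_isSymmetric hnet hnorm (by rwa [finrank_euclideanSpace_fin])
      _ (isSymmetric_crossMoment n fun t => Z t ω) (a := 27 * s * n * M) (fun v hv => by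
        rw [inner_crossMoment_self, abs_of_nonneg (by positivity)]
        exact (hcon v hv).le) x
    refine this.trans_eq ?_
    ring
  refine (measureReal_mono hsub).trans ?_
  refine (measureReal_exists_mem_le hcard' (Real.exp_pos (-(3 * p))).le fun v hv => ?_).trans
    (nine_pow_mul_exp_le p)
  have hv1 := hnorm v hv
  have hvS := inner_toEuclideanLin_le_sigmaMax S hv1
  have hcov : IsGaussianWithCovLE (fun (t : Fin n) ω => ⟪v, Z t ω⟫) μ (2 * M / (1 - γ)) :=
    (h.isGaussianWithCovLE_state hS n v).mono (by
      rw [hv1, one_pow, mul_one, mul_div_assoc', mul_comm 2 M]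
      gcongr
      linarith)
  have hr1 : 3 * (p : ℝ) ≤ (7 * s * n * M) ^ 2 / (8 * (2 * M / (1 - γ)) * (n * M)) := by
    have : (7 * s * n * M) ^ 2 / (8 * (2 * M / (1 - γ)) * (n * M)) =
        49 / 16 * (n * (1 - γ) * s ^ 2) := by
      field_simp
      ring
    rw [this]
    linarith
  have hr2 : 3 * (p : ℝ) ≤ 7 * s * n * M / (8 * (2 * M / (1 - γ))) := by
    have : 7 * s * n * M / (8 * (2 * M / (1 - γ))) = 7 / 16 * (n * (1 - γ) * s) := by
      field_simp
      ring
    rw [this]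
    linarith
  have hsum := h.sum_variance_state hS n v
  have hV : n * ⟪v, Matrix.toEuclideanLin S v⟫ ≤ n * M := by gcongr
  have htail := (hcov.measure_sum_sq_tails (τ := 7 * s * n * M) (by positivity)
    (by positivity : 0 < n * M) (by rw [hsum]; exact hV) (by positivity) hr1 hr2).1
  refine (measureReal_mono fun ω hω => ?_).trans htail
  simp only [Set.mem_ofPred_eq] at hω ⊢
  rw [hsum, ← Finset.sum_range fun t => ⟪v, Z t ω⟫ ^ 2]
  -- In this regime `20 s > 1`, so the mean is absorbed into the deviation scale: `27 = 20 + 7`,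
  -- doubled to `54` by the net.
  have : n * M ≤ 20 * s * n * M := by
    have : 1 ≤ 20 * s := by linarith
    nlinarith [mul_pos hn0 hM]
  linarith

-- The bound is relative to `S`, so it is proved for whitened vectors: the whitened second moment is
-- compared with `n` times the identity. A deviation `n/4` on the net becomes `n/2` on the sphere.
omit hM in
theorem measureReal_restricted_eigenvalue_le (hν : ν ≠ 0) (hs20 : samplingError p n γ ≤ 1 / 20) :
    μ.real {ω | ¬ ∀ x, n / 2 * ⟪x, Matrix.toEuclideanLin S x⟫ ≤
      ∑ t ∈ Finset.range n, ⟪x, Z t ω⟫ ^ 2} ≤ 2 * exp (-(1 / 2) * p) := by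
  obtain ⟨N, hcard, hnorm, hnet⟩ := exists_quarter_net (EuclideanSpace ℝ (Fin p))
  rw [finrank_euclideanSpace_fin] at hcard
  have hcard' : (N.card : ℝ) ≤ 9 ^ p := by exact_mod_cast hcard
  set s := samplingError p n γ
  have hγ0 := hS.nonneg
  have hγ1 := hS.lt_one
  have hγ : 0 < 1 - γ := by linarith
  have hn0 : (0 : ℝ) < n := lt_of_le_of_lt (by positivity) hn
  have hn0' : 0 < n := Nat.cast_pos.1 hn0
  have hs : 0 < s := samplingError_pos hp hn0' hγ1
  have hsn : 400 * (p : ℝ) ≤ n * (1 - γ) ^ 2 := by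
    rw [← mul_sq_samplingError (p := p) hn0' hγ1]
    have h1 : s ^ 2 ≤ (1 / 20) ^ 2 := by gcongr
    have h2 : 0 ≤ n * (1 - γ) ^ 2 := by positivity
    nlinarith
  obtain ⟨C, hCsurj, hC⟩ := exists_whitening (Matrix.toEuclideanLin S) hS.isSymmetric
    fun x hx => lt_of_lt_of_le (by positivity) (hS.sq_mul_norm_sq_le_inner x)
  set D : Ω → EuclideanSpace ℝ (Fin p) →ₗ[ℝ] EuclideanSpace ℝ (Fin p) := fun ω =>
    crossMoment n (fun t => C.adjoint (Z t ω)) (fun t => C.adjoint (Z t ω)) -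
      (n : ℝ) • LinearMap.id with hD
  have hDinner : ∀ ω u, ⟪u, D ω u⟫ = ∑ t ∈ Finset.range n, ⟪C u, Z t ω⟫ ^ 2 - n * ‖u‖ ^ 2 :=
    fun ω u => by
      simp only [hD, LinearMap.sub_apply, LinearMap.smul_apply, LinearMap.id_apply]
      rw [inner_sub_right, inner_crossMoment_self, real_inner_smul_right,
        real_inner_self_eq_norm_sq]
      simp_rw [LinearMap.adjoint_inner_right]
  have hDsymm : ∀ ω, (D ω).IsSymmetric := fun ω =>
    (isSymmetric_crossMoment n _).sub (LinearMap.IsSymmetric.id.smul (by simp))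
  have hsub : {ω | ¬ ∀ x, n / 2 * ⟪x, Matrix.toEuclideanLin S x⟫ ≤
      ∑ t ∈ Finset.range n, ⟪x, Z t ω⟫ ^ 2} ⊆
      {ω | ∃ u ∈ N, ¬ |⟪u, D ω u⟫| ≤ n / 4} := by
    intro ω hω
    by_contra hcon
    simp only [Set.mem_ofPred_eq, not_exists, not_and, not_not] at hcon
    refine hω fun x => ?_
    obtain ⟨u, rfl⟩ := hCsurj x
    have h1 := norm_apply_le_of_net_of_isSymmetric hnet hnorm (by rwa [finrank_euclideanSpace_fin])
      _ (hDsymm ω) hcon u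
    have h2 := neg_le_of_abs_le (abs_real_inner_le_norm u (D ω u))
    rw [hDinner] at h2
    rw [hC]
    nlinarith [norm_nonneg u, mul_le_mul_of_nonneg_left h1 (norm_nonneg u)]
  refine (measureReal_mono hsub).trans ?_
  refine (measureReal_exists_mem_le (c := 2 * exp (-(3 * p))) hcard' (by positivity)
    fun u hu => ?_).trans ?_
  · have hu1 := hnorm u hu
    have hCu : ⟪C u, Matrix.toEuclideanLin S (C u)⟫ = 1 := by rw [hC, hu1, one_pow]
    -- Whitening gives `ν² ‖Cu‖² ≤ ⟪Cu, S Cu⟫ = 1`, and `(1-γ²) σ_max(S) ≤ ν²`. The general bound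
    -- `σ_max(S) ‖Cu‖² (1+γ)/(1-γ)` is therefore at most `1/(1-γ)²`, whatever the conditioning of
    -- `S`.
    have hcov : IsGaussianWithCovLE (fun (t : Fin n) ω => ⟪C u, Z t ω⟫) μ (1 / (1 - γ) ^ 2) :=
      (h.isGaussianWithCovLE_state hS n (C u)).mono (by
        have h1 := hS.one_sub_sq_mul_singularValues_zero_le finrank_euclideanSpace_fin hp
        have h2 := hS.sq_mul_norm_sq_le_inner (C u)
        have h3 : (1 - γ ^ 2) * sigmaMax S ≤ ν ^ 2 := h1
        rw [hCu] at h2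
        rw [mul_div_assoc', div_le_div_iff₀ hγ (by positivity)]
        have h4 : (1 - γ ^ 2) * sigmaMax S * ‖C u‖ ^ 2 ≤ 1 :=
          (mul_le_mul_of_nonneg_right h3 (sq_nonneg _)).trans h2
        nlinarith)
    have hsum := h.sum_variance_state hS n (C u)
    rw [hCu, mul_one] at hsum
    have hr1 : 3 * (p : ℝ) ≤ ((n : ℝ) / 4) ^ 2 / (8 * (1 / (1 - γ) ^ 2) * n) := by
      have : ((n : ℝ) / 4) ^ 2 / (8 * (1 / (1 - γ) ^ 2) * n) = n * (1 - γ) ^ 2 / 128 := by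
        field_simp
        ring
      rw [this]
      linarith
    have hr2 : 3 * (p : ℝ) ≤ (n : ℝ) / 4 / (8 * (1 / (1 - γ) ^ 2)) := by
      have : (n : ℝ) / 4 / (8 * (1 / (1 - γ) ^ 2)) = n * (1 - γ) ^ 2 / 32 := by
        field_simp
        ring
      rw [this]
      linarith
    obtain ⟨hup, hlow⟩ := hcov.measure_sum_sq_tails (τ := n / 4) (by positivity) hn0
      hsum.le (by positivity) hr1 hr2
    rw [two_mul]
    refine (measureReal_mono ?_).trans ((measureReal_union_le _ _).trans (add_le_add hup hlow))
    intro ω hω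
    by_contra hcon
    simp only [Set.mem_union, Set.mem_ofPred_eq, not_or, not_le, hsum,
      ← Finset.sum_range fun t => ⟪C u, Z t ω⟫ ^ 2] at hcon
    refine hω ?_
    rw [hDinner, hu1, one_pow, mul_one, abs_le]
    constructor <;> linarith [hcon.1, hcon.2]
  · have := nine_pow_mul_exp_le p
    linarith

end IsStationaryGaussianVAR

end DeviationEvents

/-! ### Error bounds on the good events. -/

noncomputable section DeterministicBounds

open scoped RealInnerProductSpace

section Thresholding

variable {p : ℕ} {σ : Fin p → ℝ} {q R τ : ℝ}

theorem card_filter_mul_rpow_le (hq : 0 ≤ q) (hτ : 0 < τ) (hσ : ∀ i, 0 ≤ σ i)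
    (hR : ∑ i, (if σ i = 0 then 0 else σ i ^ q) ≤ R) :
    ((Finset.univ.filter fun i => τ < σ i).card : ℝ) * τ ^ q ≤ R := by
  refine le_trans ?_ hR
  rw [← nsmul_eq_mul, ← Finset.sum_const]
  refine (Finset.sum_le_sum (g := fun i => if σ i = 0 then 0 else σ i ^ q) fun i hi => ?_).trans
    (Finset.sum_le_sum_of_subset_of_nonneg (Finset.subset_univ _) fun i _ _ => ?_)
  · have h1 := (Finset.mem_filter.1 hi).2
    rw [if_neg (hτ.trans h1).ne']
    exact Real.rpow_le_rpow hτ.le h1.le hq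
  · split_ifs
    · exact le_rfl
    · exact Real.rpow_nonneg (hσ i) q

theorem sum_compl_filter_le (hq1 : q ≤ 1) (hτ : 0 < τ) (hσ : ∀ i, 0 ≤ σ i)
    (hR : ∑ i, (if σ i = 0 then 0 else σ i ^ q) ≤ R) :
    ∑ i ∈ (Finset.univ.filter fun i => τ < σ i)ᶜ, σ i ≤ R * τ ^ (1 - q) := by
  have hnn : ∀ i, 0 ≤ (if σ i = 0 then 0 else σ i ^ q) := fun i => by
    split_ifs
    · exact le_rfl
    · exact Real.rpow_nonneg (hσ i) q
  calc ∑ i ∈ (Finset.univ.filter fun i => τ < σ i)ᶜ, σ i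
      ≤ ∑ i ∈ (Finset.univ.filter fun i => τ < σ i)ᶜ,
          (if σ i = 0 then 0 else σ i ^ q) * τ ^ (1 - q) := by
        refine Finset.sum_le_sum fun i hi => ?_
        have h1 : σ i ≤ τ := by simpa using hi
        split_ifs with h0
        · rw [h0, zero_mul]
        · have hpos : 0 < σ i := lt_of_le_of_ne (hσ i) (Ne.symm h0)
          calc σ i = σ i ^ q * σ i ^ (1 - q) := by
                rw [← Real.rpow_add hpos, add_sub_cancel, Real.rpow_one]
            _ ≤ σ i ^ q * τ ^ (1 - q) := by
                gcongr
    _ = (∑ i ∈ (Finset.univ.filter fun i => τ < σ i)ᶜ, (if σ i = 0 then 0 else σ i ^ q)) *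
          τ ^ (1 - q) := by rw [Finset.sum_mul]
    _ ≤ R * τ ^ (1 - q) := by
        gcongr
        exact (Finset.sum_le_sum_of_subset_of_nonneg (Finset.subset_univ _)
          fun i _ _ => hnn i).trans hR

theorem sum_sq_le_of_le_one (hq1 : q ≤ 1) (hσ : ∀ i, 0 ≤ σ i) (hσ1 : ∀ i, σ i ≤ 1)
    (hR : ∑ i, (if σ i = 0 then 0 else σ i ^ q) ≤ R) : ∑ i, σ i ^ 2 ≤ R := by
  refine (Finset.sum_le_sum fun i _ => ?_).trans hR
  split_ifs with h0
  · simp [h0]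
  · rw [← Real.rpow_natCast]
    refine Real.rpow_le_rpow_of_exponent_ge (lt_of_le_of_ne (hσ i) (Ne.symm h0)) (hσ1 i) ?_
    push_cast
    linarith

/-- At the threshold `τ = λ/κ` at most `R τ^{-q}` values lie above and those below sum to at most `R
τ^{1-q}`. Completing the square gives `h² ≤ 4τ²k + 4τb`, and both terms are then at most `4 R
τ^{2-q}`. -/
theorem sq_le_of_quadratic_bound (hq : 0 ≤ q) (hq1 : q ≤ 1) (hσ : ∀ i, 0 ≤ σ i)
    (hR : ∑ i, (if σ i = 0 then 0 else σ i ^ q) ≤ R) {κ lam h : ℝ} (hκ : 0 < κ) (hlam : 0 < lam)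
    (hbound : κ * h ^ 2 ≤ 2 * lam * (√((Finset.univ.filter fun i => lam / κ < σ i).card) * h) +
      2 * lam * ∑ i ∈ (Finset.univ.filter fun i => lam / κ < σ i)ᶜ, σ i) :
    h ^ 2 ≤ 8 * R * (lam / κ) ^ (2 - q) := by
  set τ := lam / κ with hτ_def
  have hτ : 0 < τ := div_pos hlam hκ
  have h1 := card_filter_mul_rpow_le hq hτ hσ hR
  have h2 := sum_compl_filter_le hq1 hτ hσ hR
  set k : ℝ := ((Finset.univ.filter fun i => τ < σ i).card : ℝ)
  set b := ∑ i ∈ (Finset.univ.filter fun i => τ < σ i)ᶜ, σ i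
  have hk : 0 ≤ k := Nat.cast_nonneg _
  have hlamτ : lam = τ * κ := by rw [hτ_def, div_mul_cancel₀ _ hκ.ne']
  have h3 : h ^ 2 ≤ 2 * τ * (√k * h) + 2 * τ * b := by
    rw [hlamτ] at hbound
    have : κ * h ^ 2 ≤ κ * (2 * τ * (√k * h) + 2 * τ * b) := by linarith
    exact le_of_mul_le_mul_left this hκ
  have h4 : h ^ 2 ≤ 4 * (τ ^ 2 * k) + 4 * (τ * b) := by
    have h5 := Real.sq_sqrt hk
    nlinarith [sq_nonneg (h - 2 * τ * √k)]
  have h6 : τ ^ 2 * k ≤ R * τ ^ (2 - q) := by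
    have h7 : τ ^ 2 = τ ^ q * τ ^ (2 - q) := by
      rw [← Real.rpow_add hτ, add_sub_cancel]
      norm_num
    calc τ ^ 2 * k = k * τ ^ q * τ ^ (2 - q) := by rw [h7]; ring
      _ ≤ R * τ ^ (2 - q) := by gcongr
  have h8 : τ * b ≤ R * τ ^ (2 - q) := by
    have h9 : τ ^ (2 - q) = τ * τ ^ (1 - q) := by
      rw [← Real.rpow_one_add' hτ.le (by linarith)]
      congr 1
      ring
    rw [h9]
    calc τ * b ≤ τ * (R * τ ^ (1 - q)) := by gcongr
      _ = _ := by ring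
  linarith

end Thresholding

section Moments

variable {E : Type*} [NormedAddCommGroup E] [InnerProductSpace ℝ E] [FiniteDimensional ℝ E]

theorem hsInner_crossMoment (n : ℕ) (w z : ℕ → E) (B : E →ₗ[ℝ] E) :
    hsInner (crossMoment n w z) B = ∑ t ∈ Finset.range n, ⟪w t, B (z t)⟫ := by
  set e := stdOrthonormalBasis ℝ E
  rw [hsInner_eq_sum e]
  simp_rw [crossMoment_apply, sum_inner]
  rw [Finset.sum_comm]
  refine Finset.sum_congr rfl fun t _ => ?_
  rw [← LinearMap.adjoint_inner_left, ← e.sum_inner_mul_inner]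
  refine Finset.sum_congr rfl fun j _ => ?_
  rw [real_inner_smul_left, LinearMap.adjoint_inner_left, real_inner_comm (z t), mul_comm]

/-- Apply the curvature hypothesis to each row of `B`. -/
theorem mul_hsInner_le_sum_norm_sq {n : ℕ} {z : ℕ → E} {c : ℝ}
    (hc : ∀ x, c * ‖x‖ ^ 2 ≤ ∑ t ∈ Finset.range n, ⟪x, z t⟫ ^ 2) (B : E →ₗ[ℝ] E) :
    c * hsInner B B ≤ ∑ t ∈ Finset.range n, ‖B (z t)‖ ^ 2 := by
  set e := stdOrthonormalBasis ℝ E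
  rw [← hsInner_adjoint_self, ← sum_norm_sq_eq_hsInner e, Finset.mul_sum]
  refine (Finset.sum_le_sum fun j _ => hc _).trans_eq ?_
  rw [Finset.sum_comm]
  refine Finset.sum_congr rfl fun t _ => ?_
  rw [← e.sum_sq_norm_inner_right]
  refine Finset.sum_congr rfl fun j _ => ?_
  rw [LinearMap.adjoint_inner_left, Real.norm_eq_abs, sq_abs]

end Moments

variable {p n : ℕ} {q R lam : ℝ} {z : ℕ → EuclideanSpace ℝ (Fin p)}
  {Θ Θhat : Matrix (Fin p) (Fin p) ℝ}

theorem sum_ite_singularValues_le (hΘ : Θ ∈ nearLowRankBall p q R) :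
    ∑ i : Fin p, (if (Matrix.toEuclideanLin Θ).singularValues i = 0 then 0 else
      (Matrix.toEuclideanLin Θ).singularValues i ^ q) ≤ R := by
  have h : ∑ i ∈ Finset.range p, (if singVal Θ i = 0 then 0 else singVal Θ i ^ q) ≤ R := hΘ
  rw [Finset.sum_range] at h
  exact h

theorem frobNorm_sq_sub_le {w : ℕ → EuclideanSpace ℝ (Fin p)} (hn : 0 < n)
    (hrec : ∀ t, z (t + 1) = Matrix.toEuclideanLin Θ (z t) + w t)
    (hΘ : Θ ∈ nearLowRankBall p q R) (hq : 0 ≤ q) (hq1 : q ≤ 1) (hlam : 0 < lam)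
    {c : ℝ} (hc : 0 < c)
    (hcurv : ∀ x, n / 2 * (c * ‖x‖ ^ 2) ≤ ∑ t ∈ Finset.range n, ⟪x, z t⟫ ^ 2)
    (hnoise : ∀ x, ‖crossMoment n w z x‖ ≤ n * (lam / 2) * ‖x‖)
    (hsol : IsVarSolution n z lam Θhat) :
    frobNorm (Θhat - Θ) ^ 2 ≤ 8 * R * (4 * lam / c) ^ (2 - q) := by
  have hn0 : (0 : ℝ) < n := Nat.cast_pos.2 hn
  set T := Matrix.toEuclideanLin Θ with hT
  set D := Matrix.toEuclideanLin (Θhat - Θ) with hD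
  have hTD : Matrix.toEuclideanLin Θhat = T + D := by rw [hD, map_sub, hT]; abel
  have hopt : varObjective n z lam Θhat ≤ varObjective n z lam Θ := hsol (Set.mem_univ Θ)
  rw [varObjective, varObjective, nuclearNorm_eq_nuc, nuclearNorm_eq_nuc, hTD, ← hT] at hopt
  have hres : ∀ t, z (t + 1) - T (z t) = w t := fun t => by rw [hrec, add_sub_cancel_left]
  have hres' : ∀ t, ‖z (t + 1) - (T + D) (z t)‖ ^ 2 =
      ‖w t‖ ^ 2 - 2 * ⟪w t, D (z t)⟫ + ‖D (z t)‖ ^ 2 := fun t => by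
    rw [LinearMap.add_apply, ← sub_sub, hres, norm_sub_sq_real]
  simp_rw [hres, hres', Finset.sum_add_distrib, Finset.sum_sub_distrib, ← Finset.mul_sum] at hopt
  rw [← hsInner_crossMoment] at hopt
  have hquad := mul_hsInner_le_sum_norm_sq (c := n / 2 * c) (z := z) (n := n)
    (fun x => by rw [mul_assoc]; exact hcurv x) D
  set I : Finset (Fin p) := Finset.univ.filter fun i : Fin p => lam / (c / 4) < T.singularValues i
  have hIpos : ∀ i ∈ I, 0 < T.singularValues i := fun i hi =>
    lt_trans (by positivity) (Finset.mem_filter.1 hi).2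
  set N := (n : ℝ)⁻¹ • crossMoment n w z with hN
  have hNnorm : ∀ x, ‖N x‖ ≤ lam / 2 * ‖x‖ := fun x => by
    rw [hN, LinearMap.smul_apply, norm_smul, norm_inv, Real.norm_natCast, inv_mul_le_iff₀ hn0,
      ← mul_assoc]
    exact hnoise x
  have hNinner : hsInner N D = (n : ℝ)⁻¹ * hsInner (crossMoment n w z) D := by
    simp [hN, hsInner, LinearMap.smul_comp]
  have horacle := hsInner_add_nuc_sub_le finrank_euclideanSpace_fin T D N hNnorm I hIpos hlam.le
  rw [hNinner] at horacle
  -- The factor is `c/4 = (1/(2n)) · (n/2) · c`, hence the threshold `λ/(c/4)` in `I`.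
  have hstep : c / 4 * hsInner D D ≤ (n : ℝ)⁻¹ * hsInner (crossMoment n w z) D +
      lam * (nuc T p - nuc (T + D) p) := by
    have h1 : 1 / (2 * (n : ℝ)) * (n / 2 * c * hsInner D D) = c / 4 * hsInner D D := by
      field_simp
      ring
    have h2 := mul_le_mul_of_nonneg_left hquad (by positivity : 0 ≤ 1 / (2 * (n : ℝ)))
    have h3 : (n : ℝ)⁻¹ = 2 * (1 / (2 * (n : ℝ))) := by field_simp
    rw [h1] at h2
    rw [h3]
    linarith
  have hfinal := sq_le_of_quadratic_bound (h := √(hsInner D D)) hq hq1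
    (fun i => T.singularValues_nonneg i) (sum_ite_singularValues_le hΘ)
    (by positivity : 0 < c / 4) hlam (by
      rw [Real.sq_sqrt (hsInner_self_nonneg D)]
      exact hstep.trans horacle)
  rw [Real.sq_sqrt (hsInner_self_nonneg D)] at hfinal
  rw [frobNorm_sq]
  refine hfinal.trans_eq ?_
  congr 2
  field_simp

/-- Comparison with the zero matrix: the linear gain is at most `a` times the nuclear norm, which
the penalty outweighs unless that norm vanishes. -/
theorem eq_zero_of_isVarSolution (hn : 0 < n) {a : ℝ} (ha : a < lam)
    (hcross : ∀ x, ‖crossMoment n (fun t => z (t + 1)) z x‖ ≤ n * a * ‖x‖)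
    (hsol : IsVarSolution n z lam Θhat) : Θhat = 0 := by
  have hn0 : (0 : ℝ) < n := Nat.cast_pos.2 hn
  set B := Matrix.toEuclideanLin Θhat with hB
  have hopt : varObjective n z lam Θhat ≤ varObjective n z lam 0 := hsol (Set.mem_univ 0)
  rw [varObjective, varObjective, nuclearNorm_eq_nuc, nuclearNorm_eq_nuc, ← hB, map_zero] at hopt
  have hnuc0 : nuc (0 : EuclideanSpace ℝ (Fin p) →ₗ[ℝ] EuclideanSpace ℝ (Fin p)) p = 0 := by
    simp [nuc]
  simp_rw [norm_sub_sq_real, Finset.sum_add_distrib, Finset.sum_sub_distrib, ← Finset.mul_sum,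
    hnuc0] at hopt
  rw [← hsInner_crossMoment n (fun t => z (t + 1)) z B] at hopt
  simp only [LinearMap.zero_apply, inner_zero_right, norm_zero, Finset.sum_const_zero, mul_zero,
    sub_zero, ne_eq, OfNat.ofNat_ne_zero, not_false_eq_true, zero_pow, add_zero] at hopt
  have hdual := hsInner_le_nuc finrank_euclideanSpace_fin hcross B
  have hnn : 0 ≤ ∑ t ∈ Finset.range n, ‖B (z t)‖ ^ 2 := Finset.sum_nonneg fun _ _ => sq_nonneg _
  have hnucB : 0 ≤ nuc B p := Finset.sum_nonneg fun i _ => B.singularValues_nonneg _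
  have hzero : nuc B p = 0 := by
    refine le_antisymm ?_ hnucB
    have h2 := mul_le_mul_of_nonneg_left hdual (by positivity : 0 ≤ 1 / (2 * (n : ℝ)))
    have h4 := mul_nonneg (by positivity : 0 ≤ 1 / (2 * (n : ℝ))) hnn
    have h5 : 1 / (2 * (n : ℝ)) * (n * a * nuc B p) = a * nuc B p / 2 := by field_simp
    rw [h5] at h2
    nlinarith
  have hσ : ∀ i : Fin p, B.singularValues i = 0 := fun i =>
    (Finset.sum_eq_zero_iff_of_nonneg fun i _ => B.singularValues_nonneg _).1 hzero i
      (Finset.mem_univ i)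
  have hB0 : B = 0 := by
    ext1 x
    have := norm_sq_apply_eq_sum_singularValues finrank_euclideanSpace_fin B x
    simpa [hσ] using this
  exact (LinearEquiv.map_eq_zero_iff _).1 hB0

theorem frobNorm_sq_le_of_sigmaMax_le_one (hΘ : Θ ∈ nearLowRankBall p q R) (hq1 : q ≤ 1)
    (hσ : sigmaMax Θ ≤ 1) : frobNorm Θ ^ 2 ≤ R := by
  rw [frobNorm_sq, hsInner_self_eq_sum_singularValues finrank_euclideanSpace_fin]
  exact sum_sq_le_of_le_one hq1 (fun i => LinearMap.singularValues_nonneg _ _)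
    (fun i => (LinearMap.singularValues_antitone _ (Nat.zero_le _)).trans hσ)
    (sum_ite_singularValues_le hΘ)

theorem norm_crossMoment_succ_le {w : ℕ → EuclideanSpace ℝ (Fin p)} {γ a b : ℝ}
    (hrec : ∀ t, z (t + 1) = Matrix.toEuclideanLin Θ (z t) + w t)
    (hΘ : ∀ x, ‖Matrix.toEuclideanLin Θ x‖ ≤ γ * ‖x‖) (hγ : γ ≤ 1)
    (ha : ∀ x, ‖crossMoment n z z x‖ ≤ a * ‖x‖) (hb : ∀ x, ‖crossMoment n w z x‖ ≤ b * ‖x‖)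
    (x : EuclideanSpace ℝ (Fin p)) :
    ‖crossMoment n (fun t => z (t + 1)) z x‖ ≤ (a + b) * ‖x‖ := by
  have h1 : crossMoment n (fun t => z (t + 1)) z x =
      Matrix.toEuclideanLin Θ (crossMoment n z z x) + crossMoment n w z x := by
    simp_rw [crossMoment_apply, hrec, map_sum, map_smul, smul_add, Finset.sum_add_distrib]
  have h2 : ‖Matrix.toEuclideanLin Θ (crossMoment n z z x)‖ ≤ ‖crossMoment n z z x‖ :=
    (hΘ _).trans (mul_le_of_le_one_left (norm_nonneg _) hγ)
  rw [h1, add_mul]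
  exact (norm_add_le _ _).trans (add_le_add (h2.trans (ha x)) (hb x))

end DeterministicBounds

/-- The probability bound is stated for the exceptional event (as outer measure): that some optimal
solution violates the error bound has probability less than `c₂ exp (-c₃ p)`. -/
theorem corollary4 :
    ∃ c₀ c₁ c₂ c₃ : ℝ, 0 < c₀ ∧ 0 < c₁ ∧ 0 < c₂ ∧ 0 < c₃ ∧
      ∀ (Ω : Type*) [MeasurableSpace Ω] (μ : Measure Ω) [IsProbabilityMeasure μ]
        (p n : ℕ) (Θ S : Matrix (Fin p) (Fin p) ℝ) (ν γ q R : ℝ)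
        (Z W : ℕ → Ω → EuclideanSpace ℝ (Fin p)),
        0 < p → c₀ * (p : ℝ) < (n : ℝ) →
        0 < ν → 0 ≤ q → q ≤ 1 → 0 < R →
        sigmaMax Θ ≤ γ → γ < 1 →
        Θ ∈ nearLowRankBall p q R →
        IsStationaryGaussianVAR μ Θ ν Z W →
        S = Θ * S * Θ.transpose + ν ^ 2 • (1 : Matrix (Fin p) (Fin p) ℝ) →
        μ {ω | ∃ Θhat : Matrix (Fin p) (Fin p) ℝ,
            IsVarSolution n (fun t => Z t ω)
              (80 * sigmaMax S / (1 - γ) * Real.sqrt ((p : ℝ) / (n : ℝ))) Θhat ∧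
            ¬ frobNorm (Θhat - Θ) ^ 2 ≤
              c₁ * (sigmaMax S / (sigmaMin S * (1 - γ))) ^ (2 - q) * R *
                ((p : ℝ) / (n : ℝ)) ^ (1 - q / 2)}
          < ENNReal.ofReal (c₂ * Real.exp (-c₃ * (p : ℝ))) := by
  -- `819200 = 8 · 320²`, where `320 = 4 · 80` comes from the threshold `4λ/σ_min`. The bad events
  -- total at most `4 e^{-p/2}`, and `5` makes the inequality strict.
  refine ⟨100, 819200, 5, 1 / 2, by norm_num, by norm_num, by norm_num, by norm_num, ?_⟩
  intro Ω _ μ _ p n Θ S ν γ q R Z W hp hn hν hq hq1 hR hΘγ hγ1 hΘ h hSeq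
  have hS := isLyapunovSolution_toEuclideanLin hΘγ hγ1 hSeq
  have hγ0 := hS.nonneg
  have hγ : 0 < 1 - γ := by linarith
  have hn0 : (0 : ℝ) < n := lt_of_le_of_lt (by positivity) hn
  have hn0' : 0 < n := Nat.cast_pos.1 hn0
  have hmin : 0 < sigmaMin S :=
    lt_of_lt_of_le (by positivity) (hS.sq_le_singularValues_last finrank_euclideanSpace_fin hp)
  have hminmax : sigmaMin S ≤ sigmaMax S :=
    LinearMap.singularValues_antitone _ (Nat.zero_le _)
  have hM : 0 < sigmaMax S := hmin.trans_le hminmax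
  set s := samplingError p n γ with hs_def
  have hs : 0 < s := samplingError_pos hp hn0' hγ1
  have hlam : 80 * sigmaMax S / (1 - γ) * √((p : ℝ) / n) = 80 * sigmaMax S * s := by
    rw [hs_def, samplingError]
    ring
  set B := sigmaMax S / (sigmaMin S * (1 - γ)) with hB
  have hB0 : 0 < B := by positivity
  set r := √((p : ℝ) / n) with hr
  have hr0 : 0 < r := Real.sqrt_pos.2 (by positivity)
  have hrate : ((p : ℝ) / n) ^ (1 - q / 2) = r ^ (2 - q) := by
    rw [hr, Real.sqrt_eq_rpow, ← Real.rpow_mul (by positivity)]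
    congr 1
    ring
  have hBr : s ≤ B * r := by
    have h1 : B * r = sigmaMax S / sigmaMin S * s := by
      rw [hB, hs_def, samplingError, ← hr]
      field_simp
    rw [h1]
    exact le_mul_of_one_le_left hs.le ((one_le_div hmin).2 hminmax)
  have hbound : 819200 * B ^ (2 - q) * R * ((p : ℝ) / n) ^ (1 - q / 2) =
      819200 * R * (B * r) ^ (2 - q) := by
    rw [hrate, Real.mul_rpow hB0.le hr0.le]
    ring
  have hrec : ∀ ω t, Z (t + 1) ω = Matrix.toEuclideanLin Θ (Z t ω) + W t ω :=
    fun ω t => h.recursion t ω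
  have hexp := Real.exp_pos (-(1 / 2) * (p : ℝ))
  rw [← ofReal_measureReal, ENNReal.ofReal_lt_ofReal_iff (by positivity), hlam]
  refine lt_of_le_of_lt ?_ (by linarith : 4 * Real.exp (-(1 / 2) * (p : ℝ)) < _)
  have hnoise := h.measureReal_noise_le hS hp hn hM
  rw [← hs_def] at hnoise
  -- Small `s`: curvature holds and the oracle inequality applies. Large `s`: the penalty forces the
  -- zero solution.
  rcases le_or_gt s (1 / 20) with hs20 | hs20
  · have hcurv := h.measureReal_restricted_eigenvalue_le hS hp hn hν.ne' hs20
    refine (measureReal_mono ?_).trans ((measureReal_union_le _ _).trans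
      ((add_le_add hnoise hcurv).trans_eq (by ring)))
    rintro ω ⟨Θhat, hsol, hbad⟩
    by_contra hgood
    simp only [Set.mem_union, Set.mem_ofPred_eq, not_or, not_not] at hgood
    refine hbad ?_
    have h1 := frobNorm_sq_sub_le hn0' (hrec ω) hΘ hq hq1 (by positivity) hmin
      (fun x => by
        refine le_trans ?_ (hgood.2 x)
        gcongr
        exact singularValues_last_mul_norm_sq_le_inner finrank_euclideanSpace_fin _ hS.isSymmetric
          hS.inner_nonneg x)
      (fun x => (hgood.1 x).trans (by
        have : 0 ≤ s * n * sigmaMax S * ‖x‖ := by positivity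
        linarith)) hsol
    refine h1.trans ?_
    rw [hbound]
    have h2 : 4 * (80 * sigmaMax S * s) / sigmaMin S = 320 * (B * r) := by
      rw [hB, hs_def, samplingError, ← hr]
      field_simp
      ring
    rw [h2, Real.mul_rpow (by norm_num) (by positivity)]
    have h3 : (320 : ℝ) ^ (2 - q) ≤ 320 ^ (2 : ℝ) :=
      Real.rpow_le_rpow_of_exponent_le (by norm_num) (by linarith)
    have h4 : (320 : ℝ) ^ (2 : ℝ) = 102400 := by norm_num
    rw [h4] at h3
    calc 8 * R * ((320 : ℝ) ^ (2 - q) * (B * r) ^ (2 - q))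
        ≤ 8 * R * (102400 * (B * r) ^ (2 - q)) := by gcongr
      _ = _ := by ring
  · have hmom := h.measureReal_second_moment_le hS hp hn hM hs20
    rw [← hs_def] at hmom
    refine (measureReal_mono ?_).trans ((measureReal_union_le _ _).trans
      ((add_le_add hnoise hmom).trans (by linarith)))
    rintro ω ⟨Θhat, hsol, hbad⟩
    by_contra hgood
    simp only [Set.mem_union, Set.mem_ofPred_eq, not_or, not_not] at hgood
    refine hbad ?_
    have hcross := norm_crossMoment_succ_le (hrec ω) hS.norm_le hγ1.le hgood.2 hgood.1
    -- `79 = 54 + 25`, the second-moment part (passed through the contraction `Θ`) plus the noise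
    -- part, just below the `80` in `λ`.
    have hzero : Θhat = 0 := eq_zero_of_isVarSolution hn0' (a := 79 * sigmaMax S * s)
      (by
        have : 0 < sigmaMax S * s := by positivity
        linarith)
      (fun x => (hcross x).trans_eq (by ring)) hsol
    have hneg : frobNorm (Θhat - Θ) ^ 2 = frobNorm Θ ^ 2 := by
      rw [hzero, zero_sub, frobNorm_sq, frobNorm_sq, map_neg]
      simp [hsInner]
    rw [hneg, hbound]
    refine (frobNorm_sq_le_of_sigmaMax_le_one hΘ hq1 (hΘγ.trans hγ1.le)).trans ?_
    -- Since `B r ≥ s > 1/20`, the claimed bound is at least `(819200/400) R`, which exceeds `R`.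
    have h1 : (1 / 400 : ℝ) ≤ (B * r) ^ (2 - q) := by
      calc (1 / 400 : ℝ) = (1 / 20) ^ (2 : ℝ) := by norm_num
        _ ≤ (1 / 20) ^ (2 - q) :=
            Real.rpow_le_rpow_of_exponent_ge (by norm_num) (by norm_num) (by linarith)
        _ ≤ (B * r) ^ (2 - q) := by
            refine Real.rpow_le_rpow (by norm_num) ?_ (by linarith)
            linarith
    nlinarith
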